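/- Let $K$ be a metric simplicial complex combinatorially equivalent to the regular octahedron, with vertices $v_1,\dots,v_6$ in which exactly the pairs $v_2v_4$, $v_3v_5$, $v_1v_6$ (the diagonals) are not joined by an edge. Denote the edge lengths by $$p=v_1v_2,\quad q=v_1v_3,\quad r=v_1v_4,\quad s=v_1v_5,\qquad c=v_2v_3,\quad f=v_3v_4,\quad h=v_4v_5,\quad g=v_5v_2,$$ $$b=v_6v_2,\quad a=v_6v_3,\quad e=v_6v_4,\quad d=v_6v_5;$$ they are positive and satisfy the strict triangle inequalities on all eight faces. A nontrivial flex of $K$ is a continuous family of isometric realizations $P_t:K\to\mathbb{R}^3$, $t\in[0,1]$ (self-intersections allowed), along which the lengths of all three diagonals vary with $t$, i.e. none of the three is constant on a subinterval of $[0,1]$ of positive length. $K$ is called nontrivially flexible if it has a nontrivial flex. The equators are the edge cycles with consecutive lengths $(c,f,h,g)$, $(b,p,r,e)$, $(s,q,a,d)$. An equator with consecutive edge lengths $(w,x,y,z)$ is metrically symmetric if $w=y,\ x=z$, or $w=x,\ y=z$, or $w=z,\ x=y$; it has zero sum if $(w+x-y-z)(w-x+y-z)(w-x-y+z)=0$.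 Put $$\begin{aligned}B_{\varepsilon_1,\varepsilon_2,\varepsilon_3}={}&abc(h^2+s^2+r^2)-hsr(a^2+b^2+c^2)\\&+\varepsilon_1\bigl(csb(h^2+r^2-s^2)-hra(b^2+c^2-a^2)\bigr)\\&+\varepsilon_2\bigl(ahb(s^2+r^2-h^2)-src(a^2+b^2-c^2)\bigr)\\&+\varepsilon_3\bigl(cra(s^2+h^2-r^2)-shb(a^2+c^2-b^2)\bigr).\end{aligned}$$ Theorem. Every nontrivially flexible octahedron $K$ is of type A or of type B, where * type A means that all three equators are metrically symmetric; * type B means that all three equators have zero sum, that $qge=pfd$, $bhq=cdr$, $rga=sfb$, and that $B_{1,1,1}\cdot B_{1,-1,-1}\cdot B_{-1,1,-1}\cdot B_{-1,-1,1}=0$. -/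

import Mathlib

/-- The metric of a simplicial complex combinatorially equivalent to the regular octahedron.
The vertices are `v₁, …, v₆`; the pairs `v₂v₄`, `v₃v₅`, `v₁v₆` are not joined by edges.  The edges are

* `p = v₁v₂`, `q = v₁v₃`, `r = v₁v₄`, `s = v₁v₅`,
* `c = v₂v₃`, `f = v₃v₄`, `h = v₄v₅`, `g = v₅v₂`,
* `b = v₆v₂`, `a = v₆v₃`, `e = v₆v₄`, `d = v₆v₅`.

The lengths are positive and satisfy the strict triangle inequalities on the eight faces
`pqc`, `qrf`, `rsh`, `spg`, `bac`, `aef`, `edh`, `dbg`. -/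
structure OctahedronMetric where
  a : ℝ
  b : ℝ
  c : ℝ
  d : ℝ
  e : ℝ
  f : ℝ
  g : ℝ
  h : ℝ
  p : ℝ
  q : ℝ
  r : ℝ
  s : ℝ
  pos : 0 < a ∧ 0 < b ∧ 0 < c ∧ 0 < d ∧ 0 < e ∧ 0 < f ∧
    0 < g ∧ 0 < h ∧ 0 < p ∧ 0 < q ∧ 0 < r ∧ 0 < s
  face_pqc : p < q + c ∧ q < p + c ∧ c < p + q
  face_qrf : q < r + f ∧ r < q + f ∧ f < q + r
  face_rsh : r < s + h ∧ s < r + h ∧ h < r + s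
  face_spg : s < p + g ∧ p < s + g ∧ g < s + p
  face_bac : b < a + c ∧ a < b + c ∧ c < b + a
  face_aef : a < e + f ∧ e < a + f ∧ f < a + e
  face_edh : e < d + h ∧ d < e + h ∧ h < e + d
  face_dbg : d < b + g ∧ b < d + g ∧ g < d + b

namespace OctahedronMetric

/-- `P` lists the images of `v₁, …, v₆` (`P 0` is the image of `v₁`, …, `P 5` that of `v₆`) under an
isometric realization of the complex in `ℝ³`; being affine on faces, the realization is determined
by these points.  Self-intersections are allowed. -/
def IsRealization (K : OctahedronMetric) (P : Fin 6 → EuclideanSpace ℝ (Fin 3)) : Prop :=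
  dist (P 0) (P 1) = K.p ∧ dist (P 0) (P 2) = K.q ∧
  dist (P 0) (P 3) = K.r ∧ dist (P 0) (P 4) = K.s ∧
  dist (P 1) (P 2) = K.c ∧ dist (P 2) (P 3) = K.f ∧
  dist (P 3) (P 4) = K.h ∧ dist (P 4) (P 1) = K.g ∧
  dist (P 5) (P 1) = K.b ∧ dist (P 5) (P 2) = K.a ∧
  dist (P 5) (P 3) = K.e ∧ dist (P 5) (P 4) = K.d

/-- The real function `φ` on `[0, 1]` varies with `t`: it is constant on no subinterval of
positive length. -/
def VariesOnUnitInterval (φ : ℝ → ℝ) : Prop :=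
  ∀ u v : ℝ, 0 ≤ u → u < v → v ≤ 1 → ∃ t ∈ Set.Icc u v, φ t ≠ φ u

/-- `P t`, `t ∈ [0, 1]`, is a nontrivial flex of the metric complex `K`: a continuous family of
isometric realizations along which all three diagonals `v₂v₄`, `v₃v₅`, `v₁v₆` vary. -/
structure IsNontrivialFlex (K : OctahedronMetric)
    (P : ℝ → Fin 6 → EuclideanSpace ℝ (Fin 3)) : Prop where
  continuousOn : ContinuousOn P (Set.Icc 0 1)
  isRealization : ∀ t ∈ Set.Icc (0 : ℝ) 1, K.IsRealization (P t)
  varies_x : VariesOnUnitInterval fun t => dist (P t 1) (P t 3)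
  varies_y : VariesOnUnitInterval fun t => dist (P t 2) (P t 4)
  varies_z : VariesOnUnitInterval fun t => dist (P t 0) (P t 5)

/-- `K` is the metric of a nontrivially flexible octahedron. -/
def NontriviallyFlexible (K : OctahedronMetric) : Prop :=
  ∃ P : ℝ → Fin 6 → EuclideanSpace ℝ (Fin 3), K.IsNontrivialFlex P

/-- An equator with consecutive edge lengths `w, x, y, z` is metrically symmetric. -/
def EquatorSymmetric (w x y z : ℝ) : Prop :=
  (w = y ∧ x = z) ∨ (w = x ∧ y = z) ∨ (w = z ∧ x = y)

/-- An equator with consecutive edge lengths `w, x, y, z` has zero sum. -/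
def EquatorZeroSum (w x y z : ℝ) : Prop :=
  (w + x - y - z) * (w - x + y - z) * (w - x - y + z) = 0

/-- The polynomial `B_{ε₁,ε₂,ε₃}` in the edges of the opposite faces `abc` and `hsr`. -/
def B (K : OctahedronMetric) (ε₁ ε₂ ε₃ : ℝ) : ℝ :=
  K.a * K.b * K.c * (K.h ^ 2 + K.s ^ 2 + K.r ^ 2)
    - K.h * K.s * K.r * (K.a ^ 2 + K.b ^ 2 + K.c ^ 2)
    + ε₁ * (K.c * K.s * K.b * (K.h ^ 2 + K.r ^ 2 - K.s ^ 2)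
      - K.h * K.r * K.a * (K.b ^ 2 + K.c ^ 2 - K.a ^ 2))
    + ε₂ * (K.a * K.h * K.b * (K.s ^ 2 + K.r ^ 2 - K.h ^ 2)
      - K.s * K.r * K.c * (K.a ^ 2 + K.b ^ 2 - K.c ^ 2))
    + ε₃ * (K.c * K.r * K.a * (K.s ^ 2 + K.h ^ 2 - K.r ^ 2)
      - K.s * K.h * K.b * (K.a ^ 2 + K.c ^ 2 - K.b ^ 2))

/-- Type A: the three equators `cfhg`, `bpre`, `sqad` are metrically symmetric. -/
def TypeA (K : OctahedronMetric) : Prop :=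
  EquatorSymmetric K.c K.f K.h K.g ∧ EquatorSymmetric K.b K.p K.r K.e ∧
    EquatorSymmetric K.s K.q K.a K.d

/-- Type B: the three equators have zero sum, the three proportionality relations hold, and one of
the four polynomials `B` vanishes. -/
def TypeB (K : OctahedronMetric) : Prop :=
  (EquatorZeroSum K.c K.f K.h K.g ∧ EquatorZeroSum K.b K.p K.r K.e ∧
    EquatorZeroSum K.s K.q K.a K.d) ∧
  (K.q * K.g * K.e = K.p * K.f * K.d ∧ K.b * K.h * K.q = K.c * K.d * K.r ∧
    K.r * K.g * K.a = K.s * K.f * K.b) ∧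
  K.B 1 1 1 * K.B 1 (-1) (-1) * K.B (-1) 1 (-1) * K.B (-1) (-1) 1 = 0

end OctahedronMetric

/-! Along a flex the squared diagonals x, y, z become elements of one field L over ℝ, each
transcendental: L consists of germs of functions along an ultrafilter refining the comeager filter
of [0,1] (`exists_field_transcendental`). After that the argument is algebra. The link of a vertex
is a spherical quadrilateral with fixed sides, and the vanishing of a 4×4 Gram determinant is a
relation, quadratic in each variable, between the two diagonals seen from that vertex. Opposite
vertices see the same two diagonals, so their relations can be compared.

For such a pair x, z there are three situations. If neither is rational in the other, the two
quadratic equations for x over ℝ(z) are proportional, and the zeros of the leading coefficient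
recover a pair of edges (`pair_eq_of_not_mem`). If only x lies in ℝ(z), a discriminant is a square,
the links are (anti)deltoids, and x as a rational function of z recovers edges from its poles and a
signed sum of edges from its value at infinity (`pair_eq_of_mem_not_mem`). If ℝ(x) = ℝ(z), the links
are (anti)isograms and the relation reads (x − m)(z − n) = k, with m, n, k common to the two
vertices (`bilinear_of_mem_mem`).

If the three fields do not all coincide, each equator is symmetric: either opposite links match its
edges at once, or it has zero sum and equal angles yield further equations between edges
(`GenericFlex.equatorSymmetric`). This is type A. If they coincide, all six links are isograms. The
common poles give the zero sums, and comparing face areas gives the proportionalities. Composing the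
three bilinear relations forces k₁k₂k₃ < 0 (`bilinear_constants_mul_neg`), which fixes the product
of all signs involved. Unless opposite sides of an equator agree, which leads back to type A, the
edges with these signs satisfy a system whose elimination is the vanishing of some B
(`signed_B_eq_zero`). -/

open Polynomial IntermediateField

/-! ### A field of germs in which varying functions are transcendental -/

/-- Functions on a nonempty Baire space map to a field extension of `ℝ` in which every continuous
function all of whose level sets have dense complement becomes transcendental. -/
theorem exists_field_transcendental (T : Type) [TopologicalSpace T] [BaireSpace T] [Nonempty T] :
    ∃ (L : Type) (_ : Field L) (_ : Algebra ℝ L) (φ : (T → ℝ) →ₐ[ℝ] L),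
      ∀ f : T → ℝ, Continuous f → (∀ k : ℝ, Dense {t | f t ≠ k}) → Transcendental ℝ (φ f) := by
  classical
  have : (residual T).NeBot := by
    refine ⟨fun h => ?_⟩
    have h1 : (∅ : Set T) ∈ residual T := by rw [h]; exact Filter.mem_bot
    obtain ⟨x, hx⟩ := (dense_of_mem_residual h1).nonempty
    exact hx
  -- Being an ultrafilter makes the germs a field; refining `residual T` makes every dense open set
  -- large.
  let U : Ultrafilter T := Ultrafilter.of (residual T)
  let ψ : (T → ℝ) →+* (U : Filter T).Germ ℝ := Filter.Germ.coeRingHom _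
  let alg : Algebra ℝ ((U : Filter T).Germ ℝ) := (ψ.comp (Pi.constRingHom T ℝ)).toAlgebra
  let φ : (T → ℝ) →ₐ[ℝ] (U : Filter T).Germ ℝ := { ψ with commutes' := fun _ => rfl }
  refine ⟨(U : Filter T).Germ ℝ, inferInstance, alg, φ, fun f hf hd => ?_⟩
  rw [transcendental_iff]
  intro p hp
  by_contra hp0
  rw [aeval_algHom_apply] at hp
  have h1 : ∀ᶠ t in (U : Filter T), (aeval f p) t = 0 := Filter.Germ.coe_eq.1 hp
  -- A nonzero polynomial has finitely many roots, and each is avoided on a dense open set.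
  have h2 : ∀ᶠ t in (U : Filter T), ∀ k ∈ p.roots.toFinset, f t ≠ k := by
    rw [Filter.eventually_all_finset]
    intro k _
    exact Ultrafilter.of_le _ (residual_of_dense_open (isOpen_ne_fun hf continuous_const) (hd k))
  obtain ⟨t, ht1, ht2⟩ := (h1.and h2).exists
  refine ht2 (f t) ?_ rfl
  have h3 : (aeval f p) t = p.eval (f t) := by simp
  simpa [hp0, h3] using ht1

/-! ### Simple transcendental extensions of ℝ -/

section Transcendental

variable {L : Type*} [Field L] [Algebra ℝ L]

theorem Transcendental.poly_eq_zero {z : L} (hz : Transcendental ℝ z) {p : ℝ[X]}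
    (h : Polynomial.aeval z p = 0) : p = 0 := (transcendental_iff.1 hz) p h

theorem Transcendental.ne_algebraMap {z : L} (hz : Transcendental ℝ z) (k : ℝ) :
    z ≠ algebraMap ℝ L k := by
  rintro rfl
  exact hz (isAlgebraic_algebraMap k)

theorem Transcendental.quadratic {z : L} (hz : Transcendental ℝ z) {a b c : ℝ}
    (h : algebraMap ℝ L a * z ^ 2 + algebraMap ℝ L b * z + algebraMap ℝ L c = 0) :
    a = 0 ∧ b = 0 ∧ c = 0 := by
  have h1 : (C a * X ^ 2 + C b * X + C c : ℝ[X]) = 0 := by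
    apply hz.poly_eq_zero
    simpa [aeval_C] using h
  refine ⟨?_, ?_, ?_⟩
  · simpa [coeff_X, coeff_C] using congrArg (fun p : ℝ[X] => p.coeff 2) h1
  · simpa [coeff_X, coeff_C] using congrArg (fun p : ℝ[X] => p.coeff 1) h1
  · simpa [coeff_X, coeff_C] using congrArg (fun p : ℝ[X] => p.coeff 0) h1

theorem aeval_mem_adjoin_simple (z : L) (p : ℝ[X]) : aeval z p ∈ ℝ⟮z⟯ :=
  algebra_adjoin_le_adjoin _ _ (aeval_mem_adjoin_singleton _ _)

theorem algebraMap_mem_adjoin_simple (z : L) (k : ℝ) : algebraMap ℝ L k ∈ ℝ⟮z⟯ :=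
  IntermediateField.algebraMap_mem _ _

theorem adjoin_simple_mem_trans {x y z : L} (h₁ : x ∈ ℝ⟮y⟯) (h₂ : y ∈ ℝ⟮z⟯) : x ∈ ℝ⟮z⟯ :=
  adjoin_simple_le_iff.2 h₂ h₁

/-- A solution of a linear equation over `ℝ(z)` lies in `ℝ(z)`. -/
theorem mem_adjoin_simple_of_linear {x z : L} {a b : L} (ha : a ∈ ℝ⟮z⟯) (hb : b ∈ ℝ⟮z⟯)
    (h0 : a ≠ 0) (h : a * x + b = 0) : x ∈ ℝ⟮z⟯ := by
  have : x = -b / a := by field_simp; linear_combination h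
  rw [this]
  exact div_mem (neg_mem hb) ha

/-- If a product of two real polynomials in a transcendental `z` is a square in `ℝ(z)`, then every
simple root of one factor is a root of the other. -/
theorem isRoot_of_mul_eq_sq {z w : L} (hz : Transcendental ℝ z) (hw : w ∈ ℝ⟮z⟯) {G H : ℝ[X]}
    (hH : H ≠ 0) (h : w ^ 2 = aeval z (G * H)) {ρ : ℝ} (hρ : G.IsRoot ρ)
    (hρ' : ¬ (derivative G).IsRoot ρ) : H.IsRoot ρ := by
  have hG : G ≠ 0 := by rintro rfl; simp at hρ'
  obtain ⟨r, s, hrs⟩ := (mem_adjoin_simple_iff ℝ w).1 hw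
  have hinj : Function.Injective (aeval z : ℝ[X] →ₐ[ℝ] L) := transcendental_iff_injective.1 hz
  -- The representation w = r/s allows s = 0, where the quotient is 0 by convention; w = 0 is
  -- impossible since GH ≠ 0.
  by_cases hs : s = 0
  · have : w = 0 := by rw [hrs, hs]; simp
    rw [this] at h
    have h0 := hz.poly_eq_zero (p := G * H) (by rw [← h]; ring)
    exact absurd h0 (mul_ne_zero hG hH)
  have hs' : aeval z s ≠ 0 := fun h0 => hs (hz.poly_eq_zero h0)
  have key : r ^ 2 = s ^ 2 * (G * H) := by
    apply hinj
    rw [map_pow, map_mul, map_pow, ← h, hrs]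
    field_simp
  have hr0 : r ^ 2 ≠ 0 := by rw [key]; exact mul_ne_zero (pow_ne_zero 2 hs) (mul_ne_zero hG hH)
  -- Parity: the multiplicities of r² and s² are even and G contributes exactly 1, so H contributes
  -- an odd number.
  have hm := congrArg (rootMultiplicity ρ) key
  rw [rootMultiplicity_mul (key ▸ hr0), rootMultiplicity_mul (mul_ne_zero hG hH), sq, sq,
    rootMultiplicity_mul (by rwa [← sq]), rootMultiplicity_mul (by rw [← sq]; exact pow_ne_zero 2 hs)]
    at hm
  have h1 : rootMultiplicity ρ G = 1 := by
    have ha : 0 < rootMultiplicity ρ G := (rootMultiplicity_pos hG).2 hρ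
    have hb : ¬ 1 < rootMultiplicity ρ G := by
      rw [one_lt_rootMultiplicity_iff_isRoot hG]
      exact fun hh => hρ' hh.2
    omega
  rw [← rootMultiplicity_pos hH]
  omega

end Transcendental

/-! ### Spherical quadrilaterals with rationally related diagonals -/

/-- The Gram determinant of four unit vectors with consecutive inner products `α, β, γ, δ` and
diagonal inner products `X` and `Z`. -/
def sphericalGram {R : Type*} [CommRing R] (α β γ δ X Z : R) : R :=
  X ^ 2 * Z ^ 2 - X ^ 2 - Z ^ 2 - 2 * (α * γ + β * δ) * X * Z + 2 * (α * β + γ * δ) * X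
    + 2 * (α * δ + β * γ) * Z + 1 - α ^ 2 - β ^ 2 - γ ^ 2 - δ ^ 2 + (α * γ - β * δ) ^ 2

theorem sphericalGram_rotate {R : Type*} [CommRing R] (α β γ δ X Z : R) :
    sphericalGram β γ δ α Z X = sphericalGram α β γ δ X Z := by
  unfold sphericalGram; ring

section Spherical

variable {L : Type*} [Field L] [Algebra ℝ L]

/-- The hypotheses say (α ± δ)² = (β ± γ)²; the four choices of square roots are the four
conclusions. -/
theorem eq_or_eq_up_to_sign_of_mul_eq {α β γ δ : ℝ} (h₁ : α * δ = β * γ)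
    (h₂ : α ^ 2 + δ ^ 2 = β ^ 2 + γ ^ 2) :
    (∃ κ : ℝ, (κ = 1 ∨ κ = -1) ∧ α = κ * β ∧ δ = κ * γ) ∨
      ∃ ε : ℝ, (ε = 1 ∨ ε = -1) ∧ α = ε * γ ∧ β = ε * δ := by
  have e1 : (α + δ) ^ 2 = (β + γ) ^ 2 := by linear_combination h₂ + 2 * h₁
  have e2 : (α - δ) ^ 2 = (β - γ) ^ 2 := by linear_combination h₂ - 2 * h₁
  rcases sq_eq_sq_iff_eq_or_eq_neg.1 e1 with h | h <;>
    rcases sq_eq_sq_iff_eq_or_eq_neg.1 e2 with h' | h'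
  · exact Or.inl ⟨1, Or.inl rfl, by linarith, by linarith⟩
  · exact Or.inr ⟨1, Or.inl rfl, by linarith, by linarith⟩
  · exact Or.inr ⟨-1, Or.inr rfl, by linarith, by linarith⟩
  · exact Or.inl ⟨-1, Or.inr rfl, by linarith, by linarith⟩

/-- If one diagonal of a flexing spherical quadrilateral is a rational function of the other, the
quadrilateral is an (anti)deltoid or an (anti)isogram. -/
theorem deltoid_or_isogram_of_mem_adjoin {α β γ δ : ℝ} (hα : α ^ 2 < 1) (hδ : δ ^ 2 < 1)
    {X Z : L} (hZ : Transcendental ℝ Z)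
    (h : sphericalGram (algebraMap ℝ L α) (algebraMap ℝ L β) (algebraMap ℝ L γ)
      (algebraMap ℝ L δ) X Z = 0) (hX : X ∈ ℝ⟮Z⟯) :
    (∃ κ : ℝ, (κ = 1 ∨ κ = -1) ∧ α = κ * β ∧ δ = κ * γ) ∨
      ∃ ε : ℝ, (ε = 1 ∨ ε = -1) ∧ α = ε * γ ∧ β = ε * δ := by
  obtain ⟨k, hk⟩ : ∃ k : ℝ, k = 1 - α ^ 2 - δ ^ 2 := ⟨_, rfl⟩
  obtain ⟨l, hl⟩ : ∃ l : ℝ, l = 1 - β ^ 2 - γ ^ 2 := ⟨_, rfl⟩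
  let G : ℝ[X] := C k + C (2 * α * δ) * Polynomial.X - Polynomial.X ^ 2
  let H : ℝ[X] := C l + C (2 * β * γ) * Polynomial.X - Polynomial.X ^ 2
  have hH : H ≠ 0 := by
    intro h0
    simpa [H, coeff_X, coeff_C] using congrArg (fun p : ℝ[X] => p.coeff 2) h0
  -- W is half the derivative of the Gram relation as a quadratic in X. Hence W² is a quarter of its
  -- discriminant, which factors as GH, the Gram determinants of the two triangles cut off by the
  -- diagonal Z.
  let W : L := (Z ^ 2 - 1) * X + algebraMap ℝ L (α * β + γ * δ)
    - algebraMap ℝ L (α * γ + β * δ) * Z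
  have hW : W ∈ ℝ⟮Z⟯ := by
    have hZm : Z ∈ ℝ⟮Z⟯ := mem_adjoin_simple_self ℝ Z
    exact sub_mem (add_mem (mul_mem (sub_mem (pow_mem hZm 2) (one_mem _)) hX)
      (algebraMap_mem_adjoin_simple _ _)) (mul_mem (algebraMap_mem_adjoin_simple _ _) hZm)
  have hWsq : W ^ 2 = aeval Z (G * H) := by
    simp only [W, G, H, map_mul, map_sub, map_add, map_pow, aeval_X, aeval_C, map_ofNat]
    rw [hk, hl]
    simp only [map_sub, map_pow, map_one]
    unfold sphericalGram at h
    linear_combination (Z ^ 2 - 1) * h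
  -- The roots of G are αδ ± m, the cosines of the sum and difference of two sides; they are simple
  -- because m > 0, so both are roots of H.
  set m : ℝ := √((1 - α ^ 2) * (1 - δ ^ 2)) with hm
  have hpos : 0 < (1 - α ^ 2) * (1 - δ ^ 2) := mul_pos (by linarith) (by linarith)
  have hm0 : 0 < m := Real.sqrt_pos.2 hpos
  have hm2 : m ^ 2 = (1 - α ^ 2) * (1 - δ ^ 2) := Real.sq_sqrt hpos.le
  have key : ∀ ρ : ℝ, 1 - α ^ 2 - δ ^ 2 + 2 * α * δ * ρ - ρ ^ 2 = 0 → 2 * α * δ - 2 * ρ ≠ 0 →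
      1 - β ^ 2 - γ ^ 2 + 2 * β * γ * ρ - ρ ^ 2 = 0 := by
    intro ρ h1 h2
    have := isRoot_of_mul_eq_sq hZ hW hH hWsq (ρ := ρ) (by simpa [G, IsRoot, hk] using h1)
      (by simpa [G, IsRoot, one_add_one_eq_two] using h2)
    simpa [H, IsRoot, hl] using this
  have k1 := key (α * δ + m) (by linear_combination -hm2) (by intro h; linarith)
  have k2 := key (α * δ - m) (by linear_combination -hm2) (by intro h; linarith)
  have k3 : m * (α * δ - β * γ) = 0 := by linear_combination (-1 / 4) * (k1 - k2)
  have k4 : α * δ = β * γ := by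
    rcases mul_eq_zero.1 k3 with h0 | h0
    · exact absurd h0 hm0.ne'
    · linarith
  refine eq_or_eq_up_to_sign_of_mul_eq k4 ?_
  linear_combination (1 / 2) * (k1 + k2) + hm2 + 2 * (α * δ) * k4

/-- The diagonals of a flexing (anti)isogram satisfy a bilinear relation. -/
theorem isogram_relation {α β γ δ ε : ℝ} (hε : ε = 1 ∨ ε = -1) (h₁ : α = ε * γ) (h₂ : β = ε * δ)
    {X Z : L} (h : sphericalGram (algebraMap ℝ L α) (algebraMap ℝ L β) (algebraMap ℝ L γ)
      (algebraMap ℝ L δ) X Z = 0) :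
    ∃ σ : ℝ, (σ = 1 ∨ σ = -1) ∧ (X + algebraMap ℝ L σ) * (Z + algebraMap ℝ L (ε * σ)) =
      algebraMap ℝ L (ε * (α + σ * β) ^ 2) := by
  unfold sphericalGram at h
  subst h₁ h₂
  -- For an (anti)isogram the Gram determinant splits into two bilinear factors.
  have h3 : ((X + 1) * (Z + algebraMap ℝ L ε) -
      algebraMap ℝ L ε * (algebraMap ℝ L γ + algebraMap ℝ L δ) ^ 2) *
      ((X - 1) * (Z - algebraMap ℝ L ε) -
      algebraMap ℝ L ε * (algebraMap ℝ L γ - algebraMap ℝ L δ) ^ 2) = 0 := by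
    rcases hε with rfl | rfl
    · simp only [map_mul, map_one] at h ⊢
      linear_combination h
    · simp only [map_mul, map_one, map_neg] at h ⊢
      linear_combination h
  rcases mul_eq_zero.1 h3 with h4 | h4
  · refine ⟨1, Or.inl rfl, ?_⟩
    rcases hε with rfl | rfl <;>
    · simp only [map_mul, map_one, map_neg, map_add, map_pow] at h4 ⊢
      linear_combination h4
  · refine ⟨-1, Or.inr rfl, ?_⟩
    rcases hε with rfl | rfl <;>
    · simp only [map_mul, map_one, map_neg, map_add, map_pow] at h4 ⊢
      linear_combination h4

/-- A diagonal of a flexing (anti)deltoid is an explicit rational function of the other one. -/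
theorem deltoid_relation {α β γ δ κ : ℝ} (hκ : κ = 1 ∨ κ = -1) (h₁ : α = κ * β) (h₂ : δ = κ * γ)
    {X Z : L} (hX : Transcendental ℝ X) (h : sphericalGram (algebraMap ℝ L α) (algebraMap ℝ L β)
      (algebraMap ℝ L γ) (algebraMap ℝ L δ) X Z = 0) :
    (algebraMap ℝ L κ * X + 1) * (Z ^ 2 - 1) =
      algebraMap ℝ L (4 * α * δ) * Z - algebraMap ℝ L (2 * (α ^ 2 + δ ^ 2)) := by
  unfold sphericalGram at h
  subst h₁ h₂
  -- For an (anti)deltoid X − κ splits off; this factor is the folded position with constant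
  -- diagonal X.
  have h3 : (X - algebraMap ℝ L κ) * ((algebraMap ℝ L κ * X + 1) * (Z ^ 2 - 1) -
      (algebraMap ℝ L (4 * (κ * β) * (κ * γ)) * Z -
        algebraMap ℝ L (2 * ((κ * β) ^ 2 + (κ * γ) ^ 2)))) = 0 := by
    rcases hκ with rfl | rfl
    · simp only [map_mul, map_one, map_add, map_pow, map_ofNat] at h ⊢
      linear_combination h
    · simp only [map_mul, map_one, map_neg, map_add, map_pow, map_ofNat] at h ⊢
      linear_combination -h
  rcases mul_eq_zero.1 h3 with h4 | h4
  · exact absurd (sub_eq_zero.1 h4) (hX.ne_algebraMap κ)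
  · linear_combination h4

end Spherical

/-! ### Vertex links and the passage from squared diagonals to cosines -/

/-- The link of a four-valent vertex with consecutive neighbours `U₁, W₁, U₂, W₂` at distances
`u₁, w₁, u₂, w₂`, with the cosines `α, β, γ, δ` of the four face angles
`U₁W₁, W₁U₂, U₂W₂, W₂U₁`. -/
structure VertexFigure where
  u₁ : ℝ
  w₁ : ℝ
  u₂ : ℝ
  w₂ : ℝ
  α : ℝ
  β : ℝ
  γ : ℝ
  δ : ℝ
  u₁_pos : 0 < u₁
  w₁_pos : 0 < w₁
  u₂_pos : 0 < u₂
  w₂_pos : 0 < w₂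
  α_sq : α ^ 2 < 1
  β_sq : β ^ 2 < 1
  γ_sq : γ ^ 2 < 1
  δ_sq : δ ^ 2 < 1

/-- The cosine of the angle between two sides of lengths `u` and `v`, the square of the third side
being `x`. -/
noncomputable def cosOfSq {L : Type*} [Field L] [Algebra ℝ L] (u v : ℝ) (x : L) : L :=
  (algebraMap ℝ L (u ^ 2 + v ^ 2) - x) / algebraMap ℝ L (2 * u * v)

section CosOfSq

variable {L : Type*} [Field L] [Algebra ℝ L]

theorem cosOfSq_comm (u v : ℝ) (x : L) : cosOfSq u v x = cosOfSq v u x := by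
  unfold cosOfSq; rw [add_comm, mul_right_comm]

theorem mul_cosOfSq {u v : ℝ} (hu : 0 < u) (hv : 0 < v) (x : L) :
    algebraMap ℝ L (2 * u * v) * cosOfSq u v x = algebraMap ℝ L (u ^ 2 + v ^ 2) - x := by
  have : algebraMap ℝ L (2 * u * v) ≠ 0 :=
    (map_ne_zero (algebraMap ℝ L)).2 (by positivity)
  unfold cosOfSq
  field_simp

theorem cosOfSq_mem (u v : ℝ) (x : L) : cosOfSq u v x ∈ ℝ⟮x⟯ :=
  div_mem (sub_mem (algebraMap_mem_adjoin_simple _ _) (mem_adjoin_simple_self ℝ x))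
    (algebraMap_mem_adjoin_simple _ _)

theorem mem_cosOfSq {u v : ℝ} (hu : 0 < u) (hv : 0 < v) (x : L) : x ∈ ℝ⟮cosOfSq u v x⟯ := by
  have h : x = algebraMap ℝ L (u ^ 2 + v ^ 2) - algebraMap ℝ L (2 * u * v) * cosOfSq u v x := by
    rw [mul_cosOfSq hu hv]; ring
  have h2 : algebraMap ℝ L (u ^ 2 + v ^ 2) - algebraMap ℝ L (2 * u * v) * cosOfSq u v x
      ∈ ℝ⟮cosOfSq u v x⟯ :=
    sub_mem (algebraMap_mem_adjoin_simple _ _)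
      (mul_mem (algebraMap_mem_adjoin_simple _ _) (mem_adjoin_simple_self ℝ _))
  rwa [← h] at h2

theorem transcendental_cosOfSq {u v : ℝ} (hu : 0 < u) (hv : 0 < v) {x : L}
    (hx : Transcendental ℝ x) : Transcendental ℝ (cosOfSq u v x) := by
  intro h
  apply hx
  have h2 : x = algebraMap ℝ L (u ^ 2 + v ^ 2) - algebraMap ℝ L (2 * u * v) * cosOfSq u v x := by
    rw [mul_cosOfSq hu hv]; ring
  rw [h2]
  exact (isAlgebraic_algebraMap _).sub ((isAlgebraic_algebraMap _).mul h)

end CosOfSq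

/-- Positivity makes the sum square strictly larger than the difference square, so the inclusion of
two-element sets respects the order and determines sum and absolute difference. -/
theorem pair_eq_of_sq_eq {w₁ w₂ v₁ v₂ : ℝ} (hw₁ : 0 < w₁) (hw₂ : 0 < w₂) (hv₁ : 0 < v₁)
    (hv₂ : 0 < v₂)
    (h : ∀ ρ : ℝ, ρ = (w₁ + w₂) ^ 2 ∨ ρ = (w₁ - w₂) ^ 2 →
      ρ = (v₁ + v₂) ^ 2 ∨ ρ = (v₁ - v₂) ^ 2) :
    (w₁ = v₁ ∧ w₂ = v₂) ∨ (w₁ = v₂ ∧ w₂ = v₁) := by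
  have hw := mul_pos hw₁ hw₂
  have hv := mul_pos hv₁ hv₂
  have key : (w₁ + w₂) ^ 2 = (v₁ + v₂) ^ 2 ∧ (w₁ - w₂) ^ 2 = (v₁ - v₂) ^ 2 := by
    rcases h _ (Or.inl rfl) with h1 | h1 <;> rcases h _ (Or.inr rfl) with h2 | h2
    · nlinarith
    · exact ⟨h1, h2⟩
    · nlinarith
    · nlinarith
  have h1 : w₁ + w₂ = v₁ + v₂ :=
    (sq_eq_sq₀ (by positivity) (by positivity)).1 key.1
  rcases sq_eq_sq_iff_eq_or_eq_neg.1 key.2 with h2 | h2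
  · exact Or.inl ⟨by linarith, by linarith⟩
  · exact Or.inr ⟨by linarith, by linarith⟩

section Elimination

variable {L : Type*} [Field L] [Algebra ℝ L]

theorem Transcendental.linear_elim {x z : L} (hz : Transcendental ℝ z)
    {p₁ p₀ q₁ q₀ : ℝ[X]} (hp : Polynomial.aeval z p₁ * x + Polynomial.aeval z p₀ = 0)
    (hq : Polynomial.aeval z q₁ * x + Polynomial.aeval z q₀ = 0) : p₁ * q₀ = q₁ * p₀ := by
  rw [← sub_eq_zero]
  apply hz.poly_eq_zero
  simp only [map_sub, map_mul]
  linear_combination Polynomial.aeval z p₁ * hq - Polynomial.aeval z q₁ * hp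

/-- Eliminating x² leaves a linear equation over ℝ(z), which must be trivial because x is not in
ℝ(z). -/
theorem Transcendental.quadratic_elim {x z : L} (hz : Transcendental ℝ z) (hx : x ∉ ℝ⟮z⟯)
    {p₂ p₁ p₀ q₂ q₁ q₀ : ℝ[X]}
    (hp : Polynomial.aeval z p₂ * x ^ 2 + Polynomial.aeval z p₁ * x + Polynomial.aeval z p₀ = 0)
    (hq : Polynomial.aeval z q₂ * x ^ 2 + Polynomial.aeval z q₁ * x + Polynomial.aeval z q₀ = 0) :
    p₂ * q₁ = q₂ * p₁ ∧ p₂ * q₀ = q₂ * p₀ := by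
  have h : Polynomial.aeval z (p₂ * q₁ - q₂ * p₁) * x + Polynomial.aeval z (p₂ * q₀ - q₂ * p₀)
      = 0 := by
    simp only [map_sub, map_mul]
    linear_combination Polynomial.aeval z p₂ * hq - Polynomial.aeval z q₂ * hp
  have h1 : Polynomial.aeval z (p₂ * q₁ - q₂ * p₁) = 0 := by
    by_contra h0
    exact hx (mem_adjoin_simple_of_linear (aeval_mem_adjoin_simple _ _)
      (aeval_mem_adjoin_simple _ _) h0 h)
  rw [h1, zero_mul, zero_add] at h
  exact ⟨sub_eq_zero.1 (hz.poly_eq_zero h1), sub_eq_zero.1 (hz.poly_eq_zero h)⟩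

end Elimination

/-! ### Comparing two links that see the same pair of diagonals -/

namespace VertexFigure

/-- The same link with the two pairs of opposite neighbours exchanged. -/
def rotate (V : VertexFigure) : VertexFigure where
  u₁ := V.w₁
  w₁ := V.u₂
  u₂ := V.w₂
  w₂ := V.u₁
  α := V.β
  β := V.γ
  γ := V.δ
  δ := V.α
  u₁_pos := V.w₁_pos
  w₁_pos := V.u₂_pos
  u₂_pos := V.w₂_pos
  w₂_pos := V.u₁_pos
  α_sq := V.β_sq
  β_sq := V.γ_sq
  γ_sq := V.δ_sq
  δ_sq := V.α_sq

/-- The angles at the vertex come in adjacent equal (`κ = 1`) or supplementary (`κ = -1`) pairs,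
with axis `W₁W₂`. -/
def Deltoid (V : VertexFigure) (κ : ℝ) : Prop :=
  (κ = 1 ∨ κ = -1) ∧ V.α = κ * V.β ∧ V.δ = κ * V.γ

/-- Opposite angles at the vertex are equal (`ε = 1`) or supplementary (`ε = -1`). -/
def Isogram (V : VertexFigure) (ε : ℝ) : Prop :=
  (ε = 1 ∨ ε = -1) ∧ V.α = ε * V.γ ∧ V.β = ε * V.δ

variable {L : Type*} [Field L] [Algebra ℝ L]

/-- The squared diagonals `x = |U₁U₂|²` and `z = |W₁W₂|²` satisfy the relation expressing that the
four edges at the vertex lie in a three-dimensional space. -/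
def Flexes (V : VertexFigure) (x z : L) : Prop :=
  sphericalGram (algebraMap ℝ L V.α) (algebraMap ℝ L V.β) (algebraMap ℝ L V.γ)
    (algebraMap ℝ L V.δ) (cosOfSq V.u₁ V.u₂ x) (cosOfSq V.w₁ V.w₂ z) = 0

theorem Flexes.rotate {V : VertexFigure} {x z : L} (h : V.Flexes x z) : V.rotate.Flexes z x := by
  unfold Flexes at h ⊢
  simp only [VertexFigure.rotate]
  rw [cosOfSq_comm V.u₂ V.u₁, sphericalGram_rotate]
  exact h

theorem isogram_rotate {V : VertexFigure} {ε : ℝ} (h : V.Isogram ε) : V.rotate.Isogram ε := by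
  obtain ⟨h0, h1, h2⟩ := h
  refine ⟨h0, h2, ?_⟩
  simp only [rotate]
  rcases h0 with rfl | rfl <;> linarith

theorem Flexes.deltoid_or_isogram {V : VertexFigure} {x z : L} (h : V.Flexes x z)
    (hz : Transcendental ℝ z) (hxz : x ∈ ℝ⟮z⟯) : (∃ κ, V.Deltoid κ) ∨ ∃ ε, V.Isogram ε := by
  refine deltoid_or_isogram_of_mem_adjoin V.α_sq V.δ_sq
    (transcendental_cosOfSq V.w₁_pos V.w₂_pos hz) h ?_
  exact adjoin_simple_mem_trans (adjoin_simple_mem_trans (cosOfSq_mem _ _ _) hxz)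
    (mem_cosOfSq V.w₁_pos V.w₂_pos z)

theorem Flexes.mem_of_isogram {V : VertexFigure} {x z : L} (h : V.Flexes x z)
    (hz : Transcendental ℝ z) {ε : ℝ} (hV : V.Isogram ε) : x ∈ ℝ⟮z⟯ := by
  obtain ⟨σ, -, hr⟩ := isogram_relation hV.1 hV.2.1 hV.2.2 h
  have hZ := transcendental_cosOfSq V.w₁_pos V.w₂_pos hz
  refine adjoin_simple_mem_trans (mem_cosOfSq V.u₁_pos V.u₂_pos x) ?_
  refine adjoin_simple_mem_trans ?_ (cosOfSq_mem V.w₁ V.w₂ z)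
  set X := cosOfSq V.u₁ V.u₂ x
  set Z := cosOfSq V.w₁ V.w₂ z
  have hZm : Z ∈ ℝ⟮Z⟯ := mem_adjoin_simple_self ℝ Z
  have ha : Z + algebraMap ℝ L (ε * σ) ∈ ℝ⟮Z⟯ := add_mem hZm (algebraMap_mem_adjoin_simple _ _)
  refine mem_adjoin_simple_of_linear (a := Z + algebraMap ℝ L (ε * σ))
    (b := algebraMap ℝ L σ * (Z + algebraMap ℝ L (ε * σ))
      - algebraMap ℝ L (ε * (V.α + σ * V.β) ^ 2)) ha
    (sub_mem (mul_mem (algebraMap_mem_adjoin_simple _ _) ha) (algebraMap_mem_adjoin_simple _ _))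
    ?_ (by linear_combination hr)
  intro h0
  refine hZ.ne_algebraMap (-(ε * σ)) ?_
  rw [map_neg]
  linear_combination h0

theorem cos_sq_sub_one_ne_zero {Z : L} (hZ : Transcendental ℝ Z) : Z ^ 2 - 1 ≠ 0 := by
  intro h0
  have := hZ.quadratic (a := 1) (b := 0) (c := -1) (by simpa [sub_eq_add_neg] using h0)
  norm_num at this

theorem Flexes.mem_of_deltoid {V : VertexFigure} {x z : L} (h : V.Flexes x z)
    (hx : Transcendental ℝ x) (hz : Transcendental ℝ z) {κ : ℝ} (hV : V.Deltoid κ) :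
    x ∈ ℝ⟮z⟯ := by
  have hZ := transcendental_cosOfSq V.w₁_pos V.w₂_pos hz
  have hX := transcendental_cosOfSq V.u₁_pos V.u₂_pos hx
  have hr := deltoid_relation hV.1 hV.2.1 hV.2.2 hX h
  refine adjoin_simple_mem_trans (mem_cosOfSq V.u₁_pos V.u₂_pos x) ?_
  refine adjoin_simple_mem_trans ?_ (cosOfSq_mem V.w₁ V.w₂ z)
  set X := cosOfSq V.u₁ V.u₂ x
  set Z := cosOfSq V.w₁ V.w₂ z
  have hZm : Z ∈ ℝ⟮Z⟯ := mem_adjoin_simple_self ℝ Z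
  have hc := fun k : ℝ => algebraMap_mem_adjoin_simple Z k
  have ha : Z ^ 2 - 1 ∈ ℝ⟮Z⟯ := sub_mem (pow_mem hZm 2) (one_mem _)
  refine mem_adjoin_simple_of_linear (a := algebraMap ℝ L κ * (Z ^ 2 - 1))
    (b := (Z ^ 2 - 1) - (algebraMap ℝ L (4 * V.α * V.δ) * Z -
      algebraMap ℝ L (2 * (V.α ^ 2 + V.δ ^ 2))))
    (mul_mem (hc _) ha) (sub_mem ha (sub_mem (mul_mem (hc _) hZm) (hc _))) ?_
    (by linear_combination hr)
  refine mul_ne_zero ((_root_.map_ne_zero (algebraMap ℝ L)).2 ?_) (cos_sq_sub_one_ne_zero hZ)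
  rcases hV.1 with h | h <;> rw [h] <;> norm_num

/-- A link that is a deltoid about both axes has all four cosines equal up to sign, and these signs
combine to an isogram. -/
theorem Flexes.isogram_of_mem_mem {V : VertexFigure} {x z : L} (h : V.Flexes x z)
    (hx : Transcendental ℝ x) (hz : Transcendental ℝ z) (hxz : x ∈ ℝ⟮z⟯) (hzx : z ∈ ℝ⟮x⟯) :
    ∃ ε, V.Isogram ε := by
  rcases h.deltoid_or_isogram hz hxz with ⟨κ, h0, h1, h2⟩ | h1
  · rcases h.rotate.deltoid_or_isogram hx hzx with ⟨κ', h0', h1', h2'⟩ | ⟨ε, h0', h1', h2'⟩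
    · simp only [VertexFigure.rotate] at h1' h2'
      refine ⟨κ * κ', ?_, ?_, ?_⟩
      · rcases h0 with rfl | rfl <;> rcases h0' with rfl | rfl <;> norm_num
      · rw [h1, h1']; ring
      · rw [h2, h1']
        rcases h0 with rfl | rfl <;> linarith
    · simp only [VertexFigure.rotate] at h1' h2'
      refine ⟨ε, h0', ?_, h1'⟩
      rcases h0' with rfl | rfl <;> linarith
  · exact h1

theorem Flexes.deltoid_of_mem_not_mem {V : VertexFigure} {x z : L} (h : V.Flexes x z)
    (hx : Transcendental ℝ x) (hz : Transcendental ℝ z) (hxz : x ∈ ℝ⟮z⟯) (hzx : z ∉ ℝ⟮x⟯) :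
    ∃ κ, V.Deltoid κ := by
  rcases h.deltoid_or_isogram hz hxz with h1 | ⟨ε, h1⟩
  · exact h1
  · exact absurd (h.rotate.mem_of_isogram hx (isogram_rotate h1)) hzx

/-- The cosine of the angle `W₁W₂` as a polynomial in the squared diagonal. -/
noncomputable def cosPoly (V : VertexFigure) : ℝ[X] :=
  C (1 / (2 * V.w₁ * V.w₂)) * (C (V.w₁ ^ 2 + V.w₂ ^ 2) - X)

theorem aeval_cosPoly (V : VertexFigure) (z : L) :
    Polynomial.aeval z V.cosPoly = cosOfSq V.w₁ V.w₂ z := by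
  simp only [cosPoly, cosOfSq, map_mul, map_sub, Polynomial.aeval_X, Polynomial.aeval_C, map_div₀,
    map_one]
  ring

theorem cosPoly_eval_sq_eq_one_iff (V : VertexFigure) (ρ : ℝ) :
    V.cosPoly.eval ρ ^ 2 = 1 ↔ ρ = (V.w₁ + V.w₂) ^ 2 ∨ ρ = (V.w₁ - V.w₂) ^ 2 := by
  have h1 := V.w₁_pos
  have h2 := V.w₂_pos
  have h3 : V.cosPoly.eval ρ ^ 2 - 1 =
      (ρ - (V.w₁ + V.w₂) ^ 2) * (ρ - (V.w₁ - V.w₂) ^ 2) / (2 * V.w₁ * V.w₂) ^ 2 := by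
    simp only [cosPoly, eval_mul, eval_C, eval_sub, eval_X]
    field_simp
    ring
  rw [← sub_eq_zero, h3, div_eq_zero_iff, mul_eq_zero, sub_eq_zero, sub_eq_zero]
  have : (2 * V.w₁ * V.w₂) ^ 2 ≠ 0 := by positivity
  tauto

theorem cosOfSq_eq (V : VertexFigure) (x : L) : cosOfSq V.u₁ V.u₂ x =
    algebraMap ℝ L ((V.u₁ ^ 2 + V.u₂ ^ 2) / (2 * V.u₁ * V.u₂)) -
      algebraMap ℝ L (1 / (2 * V.u₁ * V.u₂)) * x := by
  simp only [cosOfSq, map_div₀, map_one]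
  ring

/-- If neither diagonal is a rational function of the other, the second pair of edges is determined
up to order by the relation between the diagonals. -/
theorem Flexes.pair_eq_of_not_mem {V V' : VertexFigure} {x z : L} (h : V.Flexes x z)
    (h' : V'.Flexes x z) (hx : Transcendental ℝ x) (hz : Transcendental ℝ z) (hxz : x ∉ ℝ⟮z⟯)
    (hzx : z ∉ ℝ⟮x⟯) :
    (V.w₁ = V'.w₁ ∧ V.w₂ = V'.w₂) ∨ (V.w₁ = V'.w₂ ∧ V.w₂ = V'.w₁) := by
  refine pair_eq_of_sq_eq V.w₁_pos V.w₂_pos V'.w₁_pos V'.w₂_pos fun ρ hρ => ?_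
  rw [← cosPoly_eval_sq_eq_one_iff] at hρ ⊢
  by_contra hne
  -- Here the cosine of the first diagonal is ax + b; the x²-coefficient vanishes exactly where the
  -- angle between W₁ and W₂ has cosine ±1.
  have expand : ∀ W : VertexFigure, W.Flexes x z → ∃ a b : ℝ, a ≠ 0 ∧
      Polynomial.aeval z (C (a ^ 2) * (W.cosPoly ^ 2 - 1)) * x ^ 2 +
      Polynomial.aeval z (C (2 * a * b) * (W.cosPoly ^ 2 - 1) + C (2 * a) *
        (C (W.α * W.β + W.γ * W.δ) - C (W.α * W.γ + W.β * W.δ) * W.cosPoly)) * x +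
      Polynomial.aeval z (C (b ^ 2) * (W.cosPoly ^ 2 - 1) + C (2 * b) *
        (C (W.α * W.β + W.γ * W.δ) - C (W.α * W.γ + W.β * W.δ) * W.cosPoly) +
        (C (2 * (W.α * W.δ + W.β * W.γ)) * W.cosPoly - W.cosPoly ^ 2 +
          C (1 - W.α ^ 2 - W.β ^ 2 - W.γ ^ 2 - W.δ ^ 2 + (W.α * W.γ - W.β * W.δ) ^ 2))) = 0 := by
    intro W hW
    refine ⟨-(1 / (2 * W.u₁ * W.u₂)), (W.u₁ ^ 2 + W.u₂ ^ 2) / (2 * W.u₁ * W.u₂), ?_, ?_⟩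
    · have := W.u₁_pos
      have := W.u₂_pos
      exact neg_ne_zero.2 (by positivity)
    · unfold Flexes sphericalGram at hW
      rw [W.cosOfSq_eq, ← W.aeval_cosPoly] at hW
      simp only [map_mul, map_sub, map_add, map_pow, map_neg, map_one, map_ofNat,
        Polynomial.aeval_C] at hW ⊢
      linear_combination hW
  obtain ⟨a, b, ha, e⟩ := expand V h
  obtain ⟨a', b', ha', e'⟩ := expand V' h'
  obtain ⟨k1, k0⟩ := hz.quadratic_elim hxz e e'
  have k1' := congrArg (Polynomial.eval ρ) k1
  have k0' := congrArg (Polynomial.eval ρ) k0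
  simp only [eval_mul, eval_add, eval_sub, eval_C, eval_pow, eval_one] at k1' k0'
  set κ := V.cosPoly.eval ρ
  set κ' := V'.cosPoly.eval ρ
  rw [hρ, sub_self] at k1' k0'
  have hne' : a' ^ 2 * (κ' ^ 2 - 1) ≠ 0 :=
    mul_ne_zero (pow_ne_zero 2 ha') (sub_ne_zero.2 hne)
  have m1 : V.α * V.β + V.γ * V.δ - (V.α * V.γ + V.β * V.δ) * κ = 0 := by
    have : (a' ^ 2 * (κ' ^ 2 - 1)) * (2 * a) *
      (V.α * V.β + V.γ * V.δ - (V.α * V.γ + V.β * V.δ) * κ) = 0 := by linear_combination -k1'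
    exact (mul_eq_zero.1 this).resolve_left (mul_ne_zero hne' (by simpa using ha))
  have m0 : 2 * (V.α * V.δ + V.β * V.γ) * κ - 1 + (1 - V.α ^ 2 - V.β ^ 2 - V.γ ^ 2 - V.δ ^ 2 +
      (V.α * V.γ - V.β * V.δ) ^ 2) = 0 := by
    rw [m1] at k0'
    have : (a' ^ 2 * (κ' ^ 2 - 1)) * (2 * (V.α * V.δ + V.β * V.γ) * κ - 1 +
        (1 - V.α ^ 2 - V.β ^ 2 - V.γ ^ 2 - V.δ ^ 2 + (V.α * V.γ - V.β * V.δ) ^ 2)) = 0 := by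
      linear_combination -k0'
    exact (mul_eq_zero.1 this).resolve_left hne'
  -- At ρ all three coefficients of V vanish. One condition is a product of two defects and another
  -- a sum of their squares; as |γ|, |δ| < 1, both defects are zero. This is a deltoid about the
  -- other axis, which would put z in ℝ(x).
  have hdelt : V.β = κ * V.γ ∧ V.α = κ * V.δ := by
    have hp : (V.α - κ * V.δ) * (V.β - κ * V.γ) = 0 := by
      linear_combination m1 + V.γ * V.δ * hρ
    have hq : (V.α * V.γ - V.β * V.δ) ^ 2 = (V.α - κ * V.δ) ^ 2 + (V.β - κ * V.γ) ^ 2 := by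
      linear_combination m0 - (V.δ ^ 2 + V.γ ^ 2) * hρ
    have hδ := V.δ_sq
    have hγ := V.γ_sq
    rcases mul_eq_zero.1 hp with h0 | h0
    · have h1 : (1 - V.δ ^ 2) * (V.β - κ * V.γ) ^ 2 = 0 := by
        have : V.α = κ * V.δ := by linarith
        rw [this] at hq
        linear_combination -hq
      have h2 := (mul_eq_zero.1 h1).resolve_left (by linarith)
      exact ⟨by linarith [pow_eq_zero_iff (two_ne_zero) |>.1 h2], by linarith⟩
    · have h1 : (1 - V.γ ^ 2) * (V.α - κ * V.δ) ^ 2 = 0 := by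
        have : V.β = κ * V.γ := by linarith
        rw [this] at hq
        linear_combination -hq
      have h2 := (mul_eq_zero.1 h1).resolve_left (by linarith)
      exact ⟨by linarith, by linarith [pow_eq_zero_iff (two_ne_zero) |>.1 h2]⟩
  exact hzx (h.rotate.mem_of_deltoid hz hx (κ := κ)
    ⟨(sq_eq_sq_iff_eq_or_eq_neg.1 (hρ.trans (one_pow 2).symm)), hdelt.1, hdelt.2⟩)

/-- If `x` is a rational function of `z` but not conversely, the vertex figures are deltoids, and
the poles and the value at infinity of this function determine edges. -/
theorem Flexes.pair_eq_of_mem_not_mem {V V' : VertexFigure} {x z : L} (h : V.Flexes x z)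
    (h' : V'.Flexes x z) (hx : Transcendental ℝ x) (hz : Transcendental ℝ z) (hxz : x ∈ ℝ⟮z⟯)
    (hzx : z ∉ ℝ⟮x⟯) :
    ∃ κ κ', V.Deltoid κ ∧ V'.Deltoid κ' ∧
      ((V.w₁ = V'.w₁ ∧ V.w₂ = V'.w₂) ∨ (V.w₁ = V'.w₂ ∧ V.w₂ = V'.w₁)) ∧
      (V.u₁ + κ * V.u₂) ^ 2 = (V'.u₁ + κ' * V'.u₂) ^ 2 := by
  obtain ⟨κ, hκ⟩ := h.deltoid_of_mem_not_mem hx hz hxz hzx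
  obtain ⟨κ', hκ'⟩ := h'.deltoid_of_mem_not_mem hx hz hxz hzx
  refine ⟨κ, κ', hκ, hκ', ?_⟩
  have relation : ∀ (W : VertexFigure) (k : ℝ), W.Flexes x z → W.Deltoid k →
      -- In this form x has possible poles only where the cosine is ±1, and value (u₁ + ku₂)² at z =
      -- ∞.
      (algebraMap ℝ L ((W.u₁ + k * W.u₂) ^ 2) - x) * (cosOfSq W.w₁ W.w₂ z ^ 2 - 1) =
        algebraMap ℝ L (2 * W.u₁ * W.u₂ * k) * (algebraMap ℝ L (4 * W.α * W.δ) *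
          cosOfSq W.w₁ W.w₂ z - algebraMap ℝ L (2 * (W.α ^ 2 + W.δ ^ 2))) := by
    intro W k hW hk
    have hX := transcendental_cosOfSq W.u₁_pos W.u₂_pos hx
    have hr := deltoid_relation hk.1 hk.2.1 hk.2.2 hX hW
    have hm := mul_cosOfSq W.u₁_pos W.u₂_pos x
    have hkk : k ^ 2 = 1 := by rcases hk.1 with h | h <;> rw [h] <;> norm_num
    have hkL : algebraMap ℝ L k ^ 2 = 1 := by rw [← map_pow, hkk, map_one]
    simp only [map_mul, map_add, map_pow, map_ofNat] at hr hm ⊢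
    set Z := cosOfSq W.w₁ W.w₂ z
    linear_combination 2 * algebraMap ℝ L W.u₁ * algebraMap ℝ L W.u₂ * algebraMap ℝ L k * hr
      - (Z ^ 2 - 1) * hm + (Z ^ 2 - 1) * (algebraMap ℝ L W.u₂ ^ 2 -
        2 * algebraMap ℝ L W.u₁ * algebraMap ℝ L W.u₂ * cosOfSq W.u₁ W.u₂ x) * hkL
  have r := relation V κ h hκ
  have r' := relation V' κ' h' hκ'
  have hw : (V.w₁ = V'.w₁ ∧ V.w₂ = V'.w₂) ∨ (V.w₁ = V'.w₂ ∧ V.w₂ = V'.w₁) := by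
    refine pair_eq_of_sq_eq V.w₁_pos V.w₂_pos V'.w₁_pos V'.w₂_pos fun ρ hρ => ?_
    rw [← cosPoly_eval_sq_eq_one_iff] at hρ ⊢
    by_contra hne
    rw [← aeval_cosPoly] at r r'
    have e := hz.linear_elim (x := x) (p₁ := V.cosPoly ^ 2 - 1)
      (p₀ := C (2 * V.u₁ * V.u₂ * κ) * (C (4 * V.α * V.δ) * V.cosPoly -
        C (2 * (V.α ^ 2 + V.δ ^ 2))) - C ((V.u₁ + κ * V.u₂) ^ 2) * (V.cosPoly ^ 2 - 1))
      (q₁ := V'.cosPoly ^ 2 - 1)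
      (q₀ := C (2 * V'.u₁ * V'.u₂ * κ') * (C (4 * V'.α * V'.δ) * V'.cosPoly -
        C (2 * (V'.α ^ 2 + V'.δ ^ 2))) - C ((V'.u₁ + κ' * V'.u₂) ^ 2) * (V'.cosPoly ^ 2 - 1))
      (by simp only [map_sub, map_mul, map_pow, map_one, Polynomial.aeval_C] at r ⊢
          linear_combination -r)
      (by simp only [map_sub, map_mul, map_pow, map_one, Polynomial.aeval_C] at r' ⊢
          linear_combination -r')
    have e' := congrArg (Polynomial.eval ρ) e
    simp only [eval_mul, eval_sub, eval_C, eval_pow, eval_one] at e'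
    set μ := V.cosPoly.eval ρ
    rw [hρ, sub_self, zero_mul, mul_zero, sub_zero] at e'
    have e2 := (mul_eq_zero.1 e'.symm).resolve_left (sub_ne_zero.2 hne)
    have hκ0 : 2 * V.u₁ * V.u₂ * κ ≠ 0 := by
      have := V.u₁_pos
      have := V.u₂_pos
      refine mul_ne_zero (by positivity) ?_
      rcases hκ.1 with h | h <;> rw [h] <;> norm_num
    have e3 := (mul_eq_zero.1 e2).resolve_left hκ0
    -- At cosine μ = ±1 the numerator is a multiple of (α − μδ)², so a pole can cancel only for an
    -- isogram.
    have e4 : (V.α - μ * V.δ) ^ 2 = 0 := by linear_combination (-1 / 2) * e3 + V.δ ^ 2 * hρ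
    have e5 : V.α = μ * V.δ := by linarith [pow_eq_zero_iff (two_ne_zero) |>.1 e4]
    have hμ := (sq_eq_sq_iff_eq_or_eq_neg.1 (hρ.trans (one_pow 2).symm))
    have hiso : V.Isogram (μ * κ) := by
      obtain ⟨h0, h1, h2⟩ := hκ
      refine ⟨?_, ?_, ?_⟩
      · rcases h0 with h | h <;> rcases hμ with h' | h' <;> rw [h, h'] <;> norm_num
      · rw [e5, h2]; ring
      · have : V.β = κ * V.α := by rw [h1]; rcases h0 with h | h <;> rw [h] <;> ring
        rw [this, e5]; ring
    exact hzx (h.rotate.mem_of_isogram hx (isogram_rotate hiso))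
  refine ⟨hw, ?_⟩
  have hZZ : cosOfSq V'.w₁ V'.w₂ z = cosOfSq V.w₁ V.w₂ z := by
    rcases hw with ⟨h1, h2⟩ | ⟨h1, h2⟩
    · rw [h1, h2]
    · rw [h1, h2, cosOfSq_comm]
  rw [hZZ] at r'
  have hZ := transcendental_cosOfSq V.w₁_pos V.w₂_pos hz
  set Z := cosOfSq V.w₁ V.w₂ z
  -- The coefficient of Z² is the difference of the two values at infinity.
  have q := hZ.quadratic (a := (V.u₁ + κ * V.u₂) ^ 2 - (V'.u₁ + κ' * V'.u₂) ^ 2)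
    (b := 2 * V'.u₁ * V'.u₂ * κ' * (4 * V'.α * V'.δ) - 2 * V.u₁ * V.u₂ * κ * (4 * V.α * V.δ))
    (c := (V'.u₁ + κ' * V'.u₂) ^ 2 - (V.u₁ + κ * V.u₂) ^ 2
      + 2 * V.u₁ * V.u₂ * κ * (2 * (V.α ^ 2 + V.δ ^ 2))
      - 2 * V'.u₁ * V'.u₂ * κ' * (2 * (V'.α ^ 2 + V'.δ ^ 2)))
    (by simp only [map_sub, map_mul, map_add, map_pow] at r r' ⊢
        linear_combination r - r')
  linarith [q.1]

/-- If the diagonals are rational functions of each other, the vertex figures are isograms and the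
diagonals satisfy a bilinear relation whose poles determine edges. -/
theorem Flexes.bilinear_of_mem_mem {V V' : VertexFigure} {x z : L} (h : V.Flexes x z)
    (h' : V'.Flexes x z) (hx : Transcendental ℝ x) (hz : Transcendental ℝ z) (hxz : x ∈ ℝ⟮z⟯)
    (hzx : z ∈ ℝ⟮x⟯) :
    ∃ σ τ σ' τ' k : ℝ, (σ = 1 ∨ σ = -1) ∧ (τ = 1 ∨ τ = -1) ∧ (σ' = 1 ∨ σ' = -1) ∧
      (τ' = 1 ∨ τ' = -1) ∧ V.Isogram (σ * τ) ∧ V'.Isogram (σ' * τ') ∧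
      0 < σ * τ * k ∧ 0 < σ' * τ' * k ∧
      (V.u₁ + σ * V.u₂) ^ 2 = (V'.u₁ + σ' * V'.u₂) ^ 2 ∧
      (V.w₁ + τ * V.w₂) ^ 2 = (V'.w₁ + τ' * V'.w₂) ^ 2 ∧
      (x - algebraMap ℝ L ((V.u₁ + σ * V.u₂) ^ 2)) *
        (z - algebraMap ℝ L ((V.w₁ + τ * V.w₂) ^ 2)) = algebraMap ℝ L k := by
  have relation : ∀ W : VertexFigure, W.Flexes x z → ∃ σ τ k : ℝ, (σ = 1 ∨ σ = -1) ∧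
      (τ = 1 ∨ τ = -1) ∧ W.Isogram (σ * τ) ∧ 0 < σ * τ * k ∧
      (x - algebraMap ℝ L ((W.u₁ + σ * W.u₂) ^ 2)) *
        (z - algebraMap ℝ L ((W.w₁ + τ * W.w₂) ^ 2)) = algebraMap ℝ L k := by
    intro W hW
    obtain ⟨ε, hε⟩ := hW.isogram_of_mem_mem hx hz hxz hzx
    obtain ⟨σ, hσ, hr⟩ := isogram_relation hε.1 hε.2.1 hε.2.2 hW
    have hσσ : σ * σ = 1 := by rcases hσ with h | h <;> rw [h] <;> norm_num
    have hεε : ε * ε = 1 := by rcases hε.1 with h | h <;> rw [h] <;> norm_num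
    have hστ : σ * (ε * σ) = ε := by linear_combination ε * hσσ
    have hu := mul_cosOfSq W.u₁_pos W.u₂_pos x
    have hw := mul_cosOfSq W.w₁_pos W.w₂_pos z
    have hrel : (x - algebraMap ℝ L ((W.u₁ + σ * W.u₂) ^ 2)) *
        (z - algebraMap ℝ L ((W.w₁ + ε * σ * W.w₂) ^ 2)) =
        algebraMap ℝ L (2 * W.u₁ * W.u₂ * (2 * W.w₁ * W.w₂) *
          (ε * (W.α + σ * W.β) ^ 2)) := by
      have e1 : x - algebraMap ℝ L ((W.u₁ + σ * W.u₂) ^ 2) =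
          -(algebraMap ℝ L (2 * W.u₁ * W.u₂) *
            (cosOfSq W.u₁ W.u₂ x + algebraMap ℝ L σ)) := by
        have : (W.u₁ + σ * W.u₂) ^ 2 = W.u₁ ^ 2 + W.u₂ ^ 2 + 2 * W.u₁ * W.u₂ * σ := by
          linear_combination W.u₂ ^ 2 * hσσ
        rw [this, map_add, map_mul _ _ σ]
        linear_combination hu
      have e2 : z - algebraMap ℝ L ((W.w₁ + ε * σ * W.w₂) ^ 2) =
          -(algebraMap ℝ L (2 * W.w₁ * W.w₂) *
            (cosOfSq W.w₁ W.w₂ z + algebraMap ℝ L (ε * σ))) := by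
        have : (W.w₁ + ε * σ * W.w₂) ^ 2 =
            W.w₁ ^ 2 + W.w₂ ^ 2 + 2 * W.w₁ * W.w₂ * (ε * σ) := by
          linear_combination W.w₂ ^ 2 * ε ^ 2 * hσσ + W.w₂ ^ 2 * hεε
        rw [this, map_add, map_mul _ _ (ε * σ)]
        linear_combination hw
      rw [e1, e2, map_mul (algebraMap ℝ L) (2 * W.u₁ * W.u₂ * (2 * W.w₁ * W.w₂)),
        map_mul (algebraMap ℝ L) (2 * W.u₁ * W.u₂), ← hr]
      ring
    refine ⟨σ, ε * σ, _, hσ, ?_, by rwa [hστ], ?_, hrel⟩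
    · rcases hσ with h | h <;> rcases hε.1 with h' | h' <;> rw [h, h'] <;> norm_num
    -- A zero constant would make x or z real; thus k has the sign ε = στ.
    · have hne : W.α + σ * W.β ≠ 0 := by
        intro h0
        rw [h0] at hrel
        simp only [ne_eq, OfNat.ofNat_ne_zero, not_false_eq_true, zero_pow, mul_zero, map_zero,
          mul_eq_zero, sub_eq_zero] at hrel
        rcases hrel with h1 | h1
        · exact hx.ne_algebraMap _ h1
        · exact hz.ne_algebraMap _ h1
      have := W.u₁_pos
      have := W.u₂_pos
      have := W.w₁_pos
      have := W.w₂_pos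
      have e : σ * (ε * σ) * (2 * W.u₁ * W.u₂ * (2 * W.w₁ * W.w₂) *
          (ε * (W.α + σ * W.β) ^ 2)) = 2 * W.u₁ * W.u₂ * (2 * W.w₁ * W.w₂) *
          (W.α + σ * W.β) ^ 2 := by
        rw [hστ]
        linear_combination 2 * W.u₁ * W.u₂ * (2 * W.w₁ * W.w₂) * (W.α + σ * W.β) ^ 2 * hεε
      rw [e]
      have := pow_pos (abs_pos.2 hne) 2
      rw [sq_abs] at this
      positivity
  obtain ⟨σ, τ, k, hσ, hτ, hi, hk, e⟩ := relation V h
  obtain ⟨σ', τ', k', hσ', hτ', hi', hk', e'⟩ := relation V' h'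
  set m := (V.u₁ + σ * V.u₂) ^ 2
  set n := (V.w₁ + τ * V.w₂) ^ 2
  set m' := (V'.u₁ + σ' * V'.u₂) ^ 2
  set n' := (V'.w₁ + τ' * V'.w₂) ^ 2
  -- Eliminating x between the two bilinear relations leaves a quadratic in z; its coefficients
  -- force equal poles and equal constants.
  have q := hz.quadratic (a := m - m') (b := (m' - m) * (n + n') + (k - k'))
    (c := (m - m') * n * n' + k' * n - k * n')
    (by
      simp only [map_sub, map_mul, map_add]
      linear_combination (z - algebraMap ℝ L n) * e' - (z - algebraMap ℝ L n') * e)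
  have hm : m = m' := by linarith [q.1]
  have hk2 : k = k' := by
    have := q.2.1
    rw [hm] at this
    linarith
  have hk0 : k ≠ 0 := by rintro rfl; simp at hk
  have hn : n = n' := by
    have h1 := q.2.2
    rw [hm, ← hk2] at h1
    have : k * (n - n') = 0 := by linear_combination h1
    linarith [(mul_eq_zero.1 this).resolve_left hk0]
  exact ⟨σ, τ, σ', τ', k, hσ, hτ, hσ', hτ', hi, hi', hk, hk2 ▸ hk', hm, hn, e⟩

end VertexFigure

/-! ### Triangles and links with prescribed edge lengths -/

/-- The strict triangle inequalities. -/
def IsTriangle (a b c : ℝ) : Prop := a < b + c ∧ b < a + c ∧ c < a + b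

/-- The cosine of the angle between the sides `u` and `v` of a triangle with third side `l`. -/
noncomputable def cosLaw (u v l : ℝ) : ℝ := (u ^ 2 + v ^ 2 - l ^ 2) / (2 * u * v)

theorem IsTriangle.pos_left {a b c : ℝ} (h : IsTriangle a b c) : 0 < a := by
  linarith [h.2.1, h.2.2]

theorem IsTriangle.swap {a b c : ℝ} (h : IsTriangle a b c) : IsTriangle b a c :=
  ⟨h.2.1, h.1, by linarith [h.2.2]⟩

theorem IsTriangle.rot {a b c : ℝ} (h : IsTriangle a b c) : IsTriangle b c a :=
  ⟨by linarith [h.2.1], by linarith [h.2.2], by linarith [h.1]⟩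

theorem IsTriangle.cosLaw_sq_lt_one {u v l : ℝ} (h : IsTriangle u v l) : cosLaw u v l ^ 2 < 1 := by
  have hu := h.pos_left
  have hv := h.swap.pos_left
  have hl := h.rot.rot.pos_left
  unfold cosLaw
  rw [div_pow, div_lt_one (by positivity)]
  -- Heron's product, positive by the strict triangle inequalities, equals (2uv)² − (u² + v² − l²)².
  have h1 := mul_pos (mul_pos (sub_pos.2 h.1) (sub_pos.2 h.2.1)) (mul_pos (sub_pos.2 h.2.2)
    (add_pos (add_pos hu hv) hl))
  nlinarith

/-- The link of a vertex in terms of the lengths of the edges at the vertex and of the edges opposite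
to it. -/
noncomputable def VertexFigure.ofLengths {u₁ w₁ u₂ w₂ l₁ l₂ l₃ l₄ : ℝ} (t₁ : IsTriangle u₁ w₁ l₁)
    (t₂ : IsTriangle w₁ u₂ l₂) (t₃ : IsTriangle u₂ w₂ l₃) (t₄ : IsTriangle w₂ u₁ l₄) :
    VertexFigure where
  u₁ := u₁
  w₁ := w₁
  u₂ := u₂
  w₂ := w₂
  α := cosLaw u₁ w₁ l₁
  β := cosLaw w₁ u₂ l₂
  γ := cosLaw u₂ w₂ l₃
  δ := cosLaw w₂ u₁ l₄
  u₁_pos := t₁.pos_left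
  w₁_pos := t₂.pos_left
  u₂_pos := t₃.pos_left
  w₂_pos := t₄.pos_left
  α_sq := t₁.cosLaw_sq_lt_one
  β_sq := t₂.cosLaw_sq_lt_one
  γ_sq := t₃.cosLaw_sq_lt_one
  δ_sq := t₄.cosLaw_sq_lt_one

/-! ### From realizations in ℝ³ to the Gram relation -/

section Geometry

/-- Four vectors in a three-dimensional space are dependent, and a dependence is a kernel vector of
the Gram matrix. -/
theorem det_gram_eq_zero (v : Fin 4 → EuclideanSpace ℝ (Fin 3)) :
    (Matrix.of fun i j => inner ℝ (v i) (v j)).det = 0 := by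
  have hv : ¬ LinearIndependent ℝ v := by
    intro h
    have := h.fintype_card_le_finrank
    simp at this
  obtain ⟨g, hg, i, hi⟩ := Fintype.not_linearIndependent_iff.1 hv
  refine Matrix.exists_mulVec_eq_zero_iff.1 ⟨g, fun h => hi (congrFun h i), ?_⟩
  funext j
  have : inner ℝ (v j) (∑ i, g i • v i) = 0 := by rw [hg, inner_zero_right]
  rw [inner_sum] at this
  simpa [Matrix.mulVec, dotProduct, inner_smul_right, mul_comm] using this

theorem sphericalGram_inner_eq_zero (v : Fin 4 → EuclideanSpace ℝ (Fin 3))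
    (hv : ∀ i, inner ℝ (v i) (v i) = 1) :
    sphericalGram (inner ℝ (v 0) (v 1)) (inner ℝ (v 1) (v 2)) (inner ℝ (v 2) (v 3))
      (inner ℝ (v 3) (v 0)) (inner ℝ (v 0) (v 2)) (inner ℝ (v 1) (v 3)) = 0 := by
  have h := det_gram_eq_zero v
  rw [Matrix.det_succ_row_zero] at h
  simp only [Fin.sum_univ_four, Matrix.det_fin_three, Matrix.submatrix_apply, Matrix.of_apply] at h
  simp only [Fin.succAbove, Fin.isValue, Fin.succ_zero_eq_one, Fin.succ_one_eq_two] at h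
  have h3 : Fin.succ (2 : Fin 3) = 3 := rfl
  simp [h3, Fin.lt_def] at h
  have hn : ∀ i, ‖v i‖ ^ 2 = 1 := fun i => by rw [← real_inner_self_eq_norm_sq, hv]
  simp only [hn] at h
  rw [real_inner_comm (v 0) (v 1), real_inner_comm (v 0) (v 2), real_inner_comm (v 3) (v 0),
    real_inner_comm (v 1) (v 2), real_inner_comm (v 1) (v 3), real_inner_comm (v 2) (v 3)] at h
  unfold sphericalGram
  linear_combination h

theorem inner_unit_eq_cosLaw {n : ℕ} {O A B : EuclideanSpace ℝ (Fin n)} {u v : ℝ}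
    (hA : dist O A = u) (hB : dist O B = v) :
    inner ℝ (u⁻¹ • (A - O)) (v⁻¹ • (B - O)) = cosLaw u v (dist A B) := by
  rw [inner_smul_left, inner_smul_right,
    real_inner_eq_norm_mul_self_add_norm_mul_self_sub_norm_sub_mul_self_div_two,
    sub_sub_sub_cancel_right, ← dist_eq_norm, ← dist_eq_norm, ← dist_eq_norm, dist_comm A O,
    dist_comm B O, hA, hB]
  unfold cosLaw
  simp only [conj_trivial]
  ring

theorem sphericalGram_cosLaw_eq_zero {O U₁ W₁ U₂ W₂ : EuclideanSpace ℝ (Fin 3)}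
    {u₁ w₁ u₂ w₂ : ℝ} (hu₁ : dist O U₁ = u₁) (hw₁ : dist O W₁ = w₁) (hu₂ : dist O U₂ = u₂)
    (hw₂ : dist O W₂ = w₂) (pu₁ : 0 < u₁) (pw₁ : 0 < w₁) (pu₂ : 0 < u₂) (pw₂ : 0 < w₂) :
    sphericalGram (cosLaw u₁ w₁ (dist U₁ W₁)) (cosLaw w₁ u₂ (dist W₁ U₂))
      (cosLaw u₂ w₂ (dist U₂ W₂)) (cosLaw w₂ u₁ (dist W₂ U₁)) (cosLaw u₁ u₂ (dist U₁ U₂))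
      (cosLaw w₁ w₂ (dist W₁ W₂)) = 0 := by
  have h := sphericalGram_inner_eq_zero ![u₁⁻¹ • (U₁ - O), w₁⁻¹ • (W₁ - O), u₂⁻¹ • (U₂ - O),
    w₂⁻¹ • (W₂ - O)] (by
      have key : ∀ (u : ℝ) (U : EuclideanSpace ℝ (Fin 3)), dist O U = u → 0 < u →
          inner ℝ (u⁻¹ • (U - O)) (u⁻¹ • (U - O)) = (1 : ℝ) := by
        intro u U h hu
        rw [inner_unit_eq_cosLaw h h, dist_self]
        unfold cosLaw
        field_simp
        ring
      intro i
      fin_cases i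
      · exact key _ _ hu₁ pu₁
      · exact key _ _ hw₁ pw₁
      · exact key _ _ hu₂ pu₂
      · exact key _ _ hw₂ pw₂)
  rw [← inner_unit_eq_cosLaw hu₁ hw₁, ← inner_unit_eq_cosLaw hw₁ hu₂, ← inner_unit_eq_cosLaw hu₂ hw₂,
    ← inner_unit_eq_cosLaw hw₂ hu₁, ← inner_unit_eq_cosLaw hu₁ hu₂, ← inner_unit_eq_cosLaw hw₁ hw₂]
  exact h

/-- The relation between the diagonals at a vertex, transported along an algebra homomorphism from
functions on the parameter space. -/
theorem VertexFigure.flexes_of_dist {T L : Type*} [Field L] [Algebra ℝ L] (φ : (T → ℝ) →ₐ[ℝ] L)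
    {u₁ w₁ u₂ w₂ l₁ l₂ l₃ l₄ : ℝ} (t₁ : IsTriangle u₁ w₁ l₁) (t₂ : IsTriangle w₁ u₂ l₂)
    (t₃ : IsTriangle u₂ w₂ l₃) (t₄ : IsTriangle w₂ u₁ l₄)
    {O U₁ W₁ U₂ W₂ : T → EuclideanSpace ℝ (Fin 3)}
    (hu₁ : ∀ t, dist (O t) (U₁ t) = u₁) (hw₁ : ∀ t, dist (O t) (W₁ t) = w₁)
    (hu₂ : ∀ t, dist (O t) (U₂ t) = u₂) (hw₂ : ∀ t, dist (O t) (W₂ t) = w₂)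
    (hl₁ : ∀ t, dist (U₁ t) (W₁ t) = l₁) (hl₂ : ∀ t, dist (W₁ t) (U₂ t) = l₂)
    (hl₃ : ∀ t, dist (U₂ t) (W₂ t) = l₃) (hl₄ : ∀ t, dist (W₂ t) (U₁ t) = l₄) :
    (VertexFigure.ofLengths t₁ t₂ t₃ t₄).Flexes (φ fun t => dist (U₁ t) (U₂ t) ^ 2)
      (φ fun t => dist (W₁ t) (W₂ t) ^ 2) := by
  have hcos : ∀ (u v : ℝ) (f : T → ℝ), φ (fun t => cosLaw u v (f t)) =
      cosOfSq u v (φ fun t => f t ^ 2) := by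
    intro u v f
    have : (fun t => cosLaw u v (f t)) = algebraMap ℝ (T → ℝ) (2 * u * v)⁻¹ *
        (algebraMap ℝ (T → ℝ) (u ^ 2 + v ^ 2) - fun t => f t ^ 2) := by
      funext t
      simp only [cosLaw, Pi.mul_apply, Pi.sub_apply, Pi.algebraMap_apply, Algebra.algebraMap_self,
        RingHom.id_apply]
      ring
    rw [this, map_mul, map_sub, AlgHom.commutes, AlgHom.commutes, map_inv₀, cosOfSq]
    ring
  have hgram : sphericalGram (algebraMap ℝ (T → ℝ) (cosLaw u₁ w₁ l₁))
      (algebraMap ℝ (T → ℝ) (cosLaw w₁ u₂ l₂)) (algebraMap ℝ (T → ℝ) (cosLaw u₂ w₂ l₃))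
      (algebraMap ℝ (T → ℝ) (cosLaw w₂ u₁ l₄)) (fun t => cosLaw u₁ u₂ (dist (U₁ t) (U₂ t)))
      (fun t => cosLaw w₁ w₂ (dist (W₁ t) (W₂ t))) = 0 := by
    funext t
    have h := sphericalGram_cosLaw_eq_zero (hu₁ t) (hw₁ t) (hu₂ t) (hw₂ t) t₁.pos_left t₂.pos_left
      t₃.pos_left t₄.pos_left
    rw [hl₁, hl₂, hl₃, hl₄] at h
    exact h
  have h := congrArg φ hgram
  unfold VertexFigure.Flexes
  simp only [VertexFigure.ofLengths]
  rw [← hcos, ← hcos]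
  simp only [sphericalGram, map_add, map_sub, map_mul, map_pow, map_one, map_ofNat, map_zero,
    AlgHom.commutes] at h ⊢
  exact h

end Geometry

/-- Each of four lengths is smaller than the sum of the other three. -/
def IsQuadrilateral (w x y z : ℝ) : Prop :=
  w < x + y + z ∧ x < w + y + z ∧ y < w + x + z ∧ z < w + x + y

/-- The weak inequalities come from two triangles on the diagonal AC; equality in one of them would
pin AC at w + x or y + z for every t. -/
theorem isQuadrilateral_of_not_const {T E : Type*} [PseudoMetricSpace E] {A B C D : T → E}
    {w x y z : ℝ} (hw : ∀ t, dist (A t) (B t) = w) (hx : ∀ t, dist (B t) (C t) = x)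
    (hy : ∀ t, dist (C t) (D t) = y) (hz : ∀ t, dist (D t) (A t) = z)
    (h : ∀ k, ∃ t, dist (A t) (C t) ≠ k) : IsQuadrilateral w x y z := by
  have h1 : ∀ t, dist (A t) (C t) ≤ w + x := fun t => by
    rw [← hw t, ← hx t]; exact dist_triangle _ _ _
  have h2 : ∀ t, dist (A t) (C t) ≤ y + z := fun t => by
    rw [← hy t, ← hz t, add_comm, dist_comm (C t), dist_comm (D t)]; exact dist_triangle _ _ _
  have h3 : ∀ t, w ≤ dist (A t) (C t) + x := fun t => by
    rw [← hw t, ← hx t, dist_comm (B t)]; exact dist_triangle _ _ _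
  have h4 : ∀ t, x ≤ w + dist (A t) (C t) := fun t => by
    rw [← hw t, ← hx t, dist_comm (A t) (B t)]; exact dist_triangle _ _ _
  have h5 : ∀ t, y ≤ dist (A t) (C t) + z := fun t => by
    rw [← hy t, ← hz t, dist_comm (D t), dist_comm (A t) (C t)]; exact dist_triangle _ _ _
  have h6 : ∀ t, z ≤ y + dist (A t) (C t) := fun t => by
    rw [← hy t, ← hz t, dist_comm (C t) (D t), dist_comm (A t) (C t)]; exact dist_triangle _ _ _
  refine ⟨?_, ?_, ?_, ?_⟩
  · obtain ⟨t, ht⟩ := h (y + z)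
    have := lt_of_le_of_ne (h2 t) ht
    linarith [h3 t]
  · obtain ⟨t, ht⟩ := h (y + z)
    have := lt_of_le_of_ne (h2 t) ht
    linarith [h4 t]
  · obtain ⟨t, ht⟩ := h (w + x)
    have := lt_of_le_of_ne (h1 t) ht
    linarith [h5 t]
  · obtain ⟨t, ht⟩ := h (w + x)
    have := lt_of_le_of_ne (h1 t) ht
    linarith [h6 t]

/-! ### The six links, generic flexes and the cyclic symmetry -/

namespace OctahedronMetric

variable (K : OctahedronMetric)

theorem triangle_pqc : IsTriangle K.p K.q K.c := K.face_pqc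
theorem triangle_qrf : IsTriangle K.q K.r K.f := K.face_qrf
theorem triangle_rsh : IsTriangle K.r K.s K.h := K.face_rsh
theorem triangle_spg : IsTriangle K.s K.p K.g := K.face_spg
theorem triangle_bac : IsTriangle K.b K.a K.c := K.face_bac
theorem triangle_aef : IsTriangle K.a K.e K.f := K.face_aef
theorem triangle_edh : IsTriangle K.e K.d K.h := K.face_edh
theorem triangle_dbg : IsTriangle K.d K.b K.g := K.face_dbg

/-- The link of `v₁`, with neighbours `v₂, v₃, v₄, v₅`. -/
noncomputable def link₁ : VertexFigure :=
  VertexFigure.ofLengths K.triangle_pqc K.triangle_qrf K.triangle_rsh K.triangle_spg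

/-- The link of `v₆`, with neighbours `v₂, v₃, v₄, v₅`. -/
noncomputable def link₆ : VertexFigure :=
  VertexFigure.ofLengths K.triangle_bac K.triangle_aef K.triangle_edh K.triangle_dbg

/-- The link of `v₃`, with neighbours `v₂, v₁, v₄, v₆`. -/
noncomputable def link₃ : VertexFigure :=
  VertexFigure.ofLengths K.triangle_pqc.rot.swap K.triangle_qrf.rot.rot.swap
    K.triangle_aef.rot.rot K.triangle_bac.rot

/-- The link of `v₅`, with neighbours `v₂, v₁, v₄, v₆`. -/
noncomputable def link₅ : VertexFigure :=
  VertexFigure.ofLengths K.triangle_spg.rot.rot K.triangle_rsh.rot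
    K.triangle_edh.rot.swap K.triangle_dbg.rot.rot.swap

/-- The link of `v₂`, with neighbours `v₃, v₁, v₅, v₆`. -/
noncomputable def link₂ : VertexFigure :=
  VertexFigure.ofLengths K.triangle_pqc.rot.rot K.triangle_spg.rot
    K.triangle_dbg.rot.swap K.triangle_bac.rot.rot.swap

/-- The link of `v₄`, with neighbours `v₃, v₁, v₅, v₆`. -/
noncomputable def link₄ : VertexFigure :=
  VertexFigure.ofLengths K.triangle_qrf.rot.swap K.triangle_rsh.rot.rot.swap
    K.triangle_edh.rot.rot K.triangle_aef.rot

/-- The algebraic content of a nontrivial flex: `x`, `y`, `z` are the squares of the diagonals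
`v₂v₄`, `v₃v₅`, `v₁v₆`, regarded as elements of a field of functions on the parameter interval. -/
structure GenericFlex (K : OctahedronMetric) {L : Type*} [Field L] [Algebra ℝ L] (x y z : L) :
    Prop where
  trans_x : Transcendental ℝ x
  trans_y : Transcendental ℝ y
  trans_z : Transcendental ℝ z
  flex₁ : K.link₁.Flexes x y
  flex₆ : K.link₆.Flexes x y
  flex₃ : K.link₃.Flexes x z
  flex₅ : K.link₅.Flexes x z
  flex₂ : K.link₂.Flexes y z
  flex₄ : K.link₄.Flexes y z
  quad_x : IsQuadrilateral K.s K.q K.a K.d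
  quad_y : IsQuadrilateral K.b K.p K.r K.e
  quad_z : IsQuadrilateral K.c K.f K.h K.g

/-- The squared diagonals enter as separate functions x, y, z so that renamed realizations yield
literally the same three elements of L. -/
theorem genericFlex_of_realizations {T L : Type*} [Field L] [Algebra ℝ L] (φ : (T → ℝ) →ₐ[ℝ] L)
    {P : T → Fin 6 → EuclideanSpace ℝ (Fin 3)} (hP : ∀ t, K.IsRealization (P t))
    {x y z : T → ℝ} (ex : ∀ t, dist (P t 1) (P t 3) ^ 2 = x t)
    (ey : ∀ t, dist (P t 2) (P t 4) ^ 2 = y t) (ez : ∀ t, dist (P t 0) (P t 5) ^ 2 = z t)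
    (hx : Transcendental ℝ (φ x)) (hy : Transcendental ℝ (φ y)) (hz : Transcendental ℝ (φ z)) :
    K.GenericFlex (φ x) (φ y) (φ z) := by
  obtain rfl := funext ex
  obtain rfl := funext ey
  obtain rfl := funext ez
  have dp : ∀ t, dist (P t 0) (P t 1) = K.p := fun t => (hP t).1
  have dq : ∀ t, dist (P t 0) (P t 2) = K.q := fun t => (hP t).2.1
  have dr : ∀ t, dist (P t 0) (P t 3) = K.r := fun t => (hP t).2.2.1
  have ds : ∀ t, dist (P t 0) (P t 4) = K.s := fun t => (hP t).2.2.2.1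
  have dc : ∀ t, dist (P t 1) (P t 2) = K.c := fun t => (hP t).2.2.2.2.1
  have df : ∀ t, dist (P t 2) (P t 3) = K.f := fun t => (hP t).2.2.2.2.2.1
  have dh : ∀ t, dist (P t 3) (P t 4) = K.h := fun t => (hP t).2.2.2.2.2.2.1
  have dg : ∀ t, dist (P t 4) (P t 1) = K.g := fun t => (hP t).2.2.2.2.2.2.2.1
  have db : ∀ t, dist (P t 5) (P t 1) = K.b := fun t => (hP t).2.2.2.2.2.2.2.2.1
  have da : ∀ t, dist (P t 5) (P t 2) = K.a := fun t => (hP t).2.2.2.2.2.2.2.2.2.1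
  have de : ∀ t, dist (P t 5) (P t 3) = K.e := fun t => (hP t).2.2.2.2.2.2.2.2.2.2.1
  have dd : ∀ t, dist (P t 5) (P t 4) = K.d := fun t => (hP t).2.2.2.2.2.2.2.2.2.2.2
  have symm : ∀ {i j : Fin 6} {l : ℝ}, (∀ t, dist (P t i) (P t j) = l) →
      ∀ t, dist (P t j) (P t i) = l := fun h t => by rw [dist_comm, h t]
  have vary : ∀ i j : Fin 6, Transcendental ℝ (φ fun t => dist (P t i) (P t j) ^ 2) →
      ∀ k, ∃ t, dist (P t i) (P t j) ≠ k := by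
    intro i j h k
    by_contra! hk
    refine h.ne_algebraMap (k ^ 2) ?_
    rw [← AlgHom.commutes φ]
    congr 1
    funext t
    simp [hk t]
  refine ⟨hx, hy, hz, ?_, ?_, ?_, ?_, ?_, ?_, ?_, ?_, ?_⟩
  · exact VertexFigure.flexes_of_dist φ _ _ _ _ dp dq dr ds dc df dh dg
  · exact VertexFigure.flexes_of_dist φ _ _ _ _ db da de dd dc df dh dg
  · exact VertexFigure.flexes_of_dist φ _ _ _ _ (symm dc) (symm dq) df (symm da) (symm dp) dr
      (symm de) db
  · exact VertexFigure.flexes_of_dist φ _ _ _ _ dg (symm ds) (symm dh) (symm dd) (symm dp) dr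
      (symm de) db
  · exact VertexFigure.flexes_of_dist φ _ _ _ _ dc (symm dp) (symm dg) (symm db) (symm dq) ds
      (symm dd) da
  · exact VertexFigure.flexes_of_dist φ _ _ _ _ (symm df) (symm dr) dh (symm de) (symm dq) ds
      (symm dd) da
  · exact isQuadrilateral_of_not_const (symm ds) dq (symm da) dd (vary 4 2 (by
      simpa only [dist_comm] using hy))
  · exact isQuadrilateral_of_not_const db (symm dp) dr (symm de) (vary 5 0 (by
      simpa only [dist_comm] using hz))
  · exact isQuadrilateral_of_not_const dc df dh dg (vary 1 3 hx)

/-- The metric obtained by renaming the vertices along `v₁ → v₂ → v₃ → v₁`,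
`v₄ → v₅ → v₆ → v₄`. -/
def rotate : OctahedronMetric where
  a := K.r
  b := K.f
  c := K.q
  d := K.e
  e := K.h
  f := K.s
  g := K.a
  h := K.d
  p := K.c
  q := K.p
  r := K.g
  s := K.b
  pos := by have := K.pos; tauto
  face_pqc := K.triangle_pqc.rot.rot
  face_qrf := K.triangle_spg.rot
  face_rsh := K.triangle_dbg.rot.swap
  face_spg := K.triangle_bac.rot.rot.swap
  face_bac := K.triangle_qrf.rot.swap
  face_aef := K.triangle_rsh.rot.rot.swap
  face_edh := K.triangle_edh.rot.rot
  face_dbg := K.triangle_aef.rot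

/-- The renaming of the vertices underlying `OctahedronMetric.rotate`. -/
def rotateVertex : Fin 6 → Fin 6 := ![1, 2, 0, 4, 5, 3]

variable {K} in
theorem IsRealization.rotate {P : Fin 6 → EuclideanSpace ℝ (Fin 3)} (h : K.IsRealization P) :
    K.rotate.IsRealization (P ∘ rotateVertex) := by
  obtain ⟨dp, dq, dr, ds, dc, df, dh, dg, db, da, de, dd⟩ := h
  refine ⟨dc, ?_, ?_, ?_, ?_, ds, ?_, da, ?_, ?_, dh, ?_⟩
  · exact (dist_comm _ _).trans dp
  · exact (dist_comm _ _).trans dg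
  · exact (dist_comm _ _).trans db
  · exact (dist_comm _ _).trans dq
  · exact (dist_comm _ _).trans dd
  · exact (dist_comm _ _).trans df
  · exact (dist_comm _ _).trans dr
  · exact (dist_comm _ _).trans de

/-- Near any point lies an interval on which φ takes two values; as φ ≥ 0, their squares differ and
cannot both be k. -/
theorem dense_ne_of_varies {φ : ℝ → ℝ} (h0 : ∀ t, 0 ≤ φ t) (h : VariesOnUnitInterval φ) (k : ℝ) :
    Dense {t : Set.Icc (0 : ℝ) 1 | φ t ^ 2 ≠ k} := by
  rw [Metric.dense_iff]
  intro t₀ ε hε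
  obtain ⟨u, v, hu, huv, hv, hball⟩ : ∃ u v : ℝ, 0 ≤ u ∧ u < v ∧ v ≤ 1 ∧
      ∀ t ∈ Set.Icc u v, |t - t₀| < ε := by
    obtain ⟨t₀, h1, h2⟩ := t₀
    by_cases ht : t₀ < 1
    · refine ⟨t₀, min 1 (t₀ + ε / 2), h1, lt_min ht (by linarith), min_le_left _ _, ?_⟩
      intro t ht'
      have := ht'.2.trans (min_le_right _ _)
      rw [abs_lt]
      constructor <;> simp only <;> linarith [ht'.1]
    -- At the right endpoint the interval has to be taken to the left.
    · have ht1 : t₀ = 1 := le_antisymm h2 (not_lt.1 ht)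
      refine ⟨max 0 (1 - ε / 2), 1, le_max_left _ _, max_lt one_pos (by linarith), le_rfl, ?_⟩
      intro t ht'
      have := (le_max_right _ _).trans ht'.1
      rw [abs_lt]
      constructor <;> simp only <;> linarith [ht'.2]
  obtain ⟨t, ht, hne⟩ := h u v hu huv hv
  have hmem : ∀ s ∈ Set.Icc u v, φ s ^ 2 ≠ k →
      (Metric.ball t₀ ε ∩ {t : Set.Icc (0 : ℝ) 1 | φ t ^ 2 ≠ k}).Nonempty := fun s hs hk =>
    ⟨⟨s, hu.trans hs.1, hs.2.trans hv⟩, by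
      rw [Metric.mem_ball, Subtype.dist_eq, Real.dist_eq]; exact hball s hs, hk⟩
  by_cases hk : φ t ^ 2 = k
  · refine hmem u (Set.left_mem_Icc.2 huv.le) fun hk' => hne ?_
    exact (sq_eq_sq₀ (h0 _) (h0 _)).1 (hk.trans hk'.symm)
  · exact hmem t ht hk

/-- A nontrivial flex gives a generic flex of the metric and of its rotations. -/
theorem NontriviallyFlexible.exists_genericFlex {K : OctahedronMetric}
    (h : K.NontriviallyFlexible) :
    ∃ (L : Type) (_ : Field L) (_ : Algebra ℝ L) (x y z : L), K.GenericFlex x y z ∧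
      K.rotate.GenericFlex y z x ∧ K.rotate.rotate.GenericFlex z x y := by
  obtain ⟨P, hP⟩ := h
  obtain ⟨L, hL, hA, φ, hφ⟩ := exists_field_transcendental (Set.Icc (0 : ℝ) 1)
  have hc : Continuous fun t : Set.Icc (0 : ℝ) 1 => P t :=
    continuousOn_iff_continuous_domRestrict.1 hP.continuousOn
  have htr : ∀ i j : Fin 6, VariesOnUnitInterval (fun t => dist (P t i) (P t j)) →
      Transcendental ℝ (φ fun t : Set.Icc (0 : ℝ) 1 => dist (P t i) (P t j) ^ 2) := by
    intro i j hij
    have h1 : Continuous fun t : Set.Icc (0 : ℝ) 1 => P t i := (continuous_apply i).comp hc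
    have h2 : Continuous fun t : Set.Icc (0 : ℝ) 1 => P t j := (continuous_apply j).comp hc
    refine hφ _ ((h1.dist h2).pow 2) fun k => ?_
    exact dense_ne_of_varies (φ := fun t => dist (P t i) (P t j)) (fun _ => dist_nonneg) hij k
  have hx := htr _ _ hP.varies_x
  have hy := htr _ _ hP.varies_y
  have hz := htr _ _ hP.varies_z
  have hr : ∀ t : Set.Icc (0 : ℝ) 1, K.IsRealization (P t) := fun t => hP.isRealization t t.2
  refine ⟨L, hL, hA, _, _, _, K.genericFlex_of_realizations φ hr (fun _ => rfl) (fun _ => rfl)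
    (fun _ => rfl) hx hy hz, ?_, ?_⟩
  · exact K.rotate.genericFlex_of_realizations φ (fun t => (hr t).rotate) (fun _ => rfl)
      (fun _ => rfl) (fun _ => rfl) hy hz hx
  · exact K.rotate.rotate.genericFlex_of_realizations φ (fun t => (hr t).rotate.rotate)
      (fun _ => rfl) (fun _ => rfl) (fun _ => rfl) hz hx hy

end OctahedronMetric

/-! ### Face areas -/

/-- Four times the area of a triangle with sides `a`, `b`, `c`. -/
noncomputable def fourArea (a b c : ℝ) : ℝ :=
  √(2 * a ^ 2 * b ^ 2 + 2 * b ^ 2 * c ^ 2 + 2 * c ^ 2 * a ^ 2 - a ^ 4 - b ^ 4 - c ^ 4)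

theorem fourArea_rot (a b c : ℝ) : fourArea b c a = fourArea a b c := by
  unfold fourArea; congr 1; ring

theorem fourArea_rot' (a b c : ℝ) : fourArea c a b = fourArea a b c := by
  unfold fourArea; congr 1; ring

theorem fourArea_reverse (a b c : ℝ) : fourArea c b a = fourArea a b c := by
  unfold fourArea; congr 1; ring

theorem fourArea_swap' (a b c : ℝ) : fourArea a c b = fourArea a b c := by
  unfold fourArea; congr 1; ring

namespace IsTriangle

variable {u v l u' v' l' : ℝ}

theorem heron_eq (h : IsTriangle u v l) :
    2 * u ^ 2 * v ^ 2 + 2 * v ^ 2 * l ^ 2 + 2 * l ^ 2 * u ^ 2 - u ^ 4 - v ^ 4 - l ^ 4 =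
      4 * (u * v) ^ 2 * (1 - cosLaw u v l ^ 2) := by
  have hu := h.pos_left
  have hv := h.swap.pos_left
  unfold cosLaw
  field_simp
  ring

theorem fourArea_pos (h : IsTriangle u v l) : 0 < fourArea u v l := by
  have hu := h.pos_left
  have hv := h.swap.pos_left
  refine Real.sqrt_pos.2 ?_
  rw [h.heron_eq]
  have := h.cosLaw_sq_lt_one
  exact mul_pos (by positivity) (by linarith)

theorem fourArea_sq (h : IsTriangle u v l) :
    fourArea u v l ^ 2 = 4 * (u * v) ^ 2 * (1 - cosLaw u v l ^ 2) := by
  rw [← h.heron_eq]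
  refine Real.sq_sqrt (Real.sqrt_pos.1 h.fourArea_pos).le

/-- Triangles with equal or supplementary angles have areas proportional to the products of the
adjacent sides. -/
theorem fourArea_mul_of_cosLaw (h : IsTriangle u v l) (h' : IsTriangle u' v' l') {κ : ℝ}
    (hκ : κ = 1 ∨ κ = -1) (hc : cosLaw u v l = κ * cosLaw u' v' l') :
    fourArea u v l * (u' * v') = fourArea u' v' l' * (u * v) := by
  have h1 := h.pos_left
  have h2 := h.swap.pos_left
  have h3 := h'.pos_left
  have h4 := h'.swap.pos_left
  have h5 := h.fourArea_pos
  have h6 := h'.fourArea_pos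
  refine (sq_eq_sq₀ (by positivity) (by positivity)).1 ?_
  rw [mul_pow, mul_pow (fourArea u' v' l'), h.fourArea_sq, h'.fourArea_sq, hc]
  have : κ ^ 2 = 1 := by rcases hκ with h | h <;> rw [h] <;> norm_num
  linear_combination (-4) * (u * v) ^ 2 * (u' * v') ^ 2 * cosLaw u' v' l' ^ 2 * this

end IsTriangle

namespace VertexFigure

variable {u₁ w₁ u₂ w₂ l₁ l₂ l₃ l₄ : ℝ} {t₁ : IsTriangle u₁ w₁ l₁}
  {t₂ : IsTriangle w₁ u₂ l₂} {t₃ : IsTriangle u₂ w₂ l₃} {t₄ : IsTriangle w₂ u₁ l₄}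

/-- Equal and supplementary angles have the same sine, so passing from cosines to areas removes the
sign κ; the side shared by the two triangles cancels. -/
theorem fourArea_of_deltoid {κ : ℝ} (h : (ofLengths t₁ t₂ t₃ t₄).Deltoid κ) :
    fourArea u₁ w₁ l₁ * u₂ = fourArea w₁ u₂ l₂ * u₁ ∧
      fourArea w₂ u₁ l₄ * u₂ = fourArea u₂ w₂ l₃ * u₁ := by
  obtain ⟨h0, h1, h2⟩ := h
  constructor
  · have := t₁.fourArea_mul_of_cosLaw t₂ h0 h1
    refine mul_right_cancel₀ t₂.pos_left.ne' ?_
    linear_combination this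
  · have := t₄.fourArea_mul_of_cosLaw t₃ h0 h2
    refine mul_right_cancel₀ t₄.pos_left.ne' ?_
    linear_combination this

theorem fourArea_of_deltoid_rotate {κ : ℝ} (h : (ofLengths t₁ t₂ t₃ t₄).rotate.Deltoid κ) :
    fourArea w₁ u₂ l₂ * w₂ = fourArea u₂ w₂ l₃ * w₁ ∧
      fourArea u₁ w₁ l₁ * w₂ = fourArea w₂ u₁ l₄ * w₁ := by
  obtain ⟨h0, h1, h2⟩ := h
  constructor
  · have := t₂.fourArea_mul_of_cosLaw t₃ h0 h1
    refine mul_right_cancel₀ t₃.pos_left.ne' ?_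
    linear_combination this
  · have := t₁.fourArea_mul_of_cosLaw t₄ h0 h2
    refine mul_right_cancel₀ t₁.pos_left.ne' ?_
    linear_combination this

theorem fourArea_of_isogram {ε : ℝ} (h : (ofLengths t₁ t₂ t₃ t₄).Isogram ε) :
    fourArea u₁ w₁ l₁ * (u₂ * w₂) = fourArea u₂ w₂ l₃ * (u₁ * w₁) ∧
      fourArea w₁ u₂ l₂ * (w₂ * u₁) = fourArea w₂ u₁ l₄ * (w₁ * u₂) :=
  ⟨t₁.fourArea_mul_of_cosLaw t₃ h.1 h.2.1, t₂.fourArea_mul_of_cosLaw t₄ h.1 h.2.2⟩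

end VertexFigure

theorem cosLaw_cross_mul {u v l u' v' l' κ : ℝ} (hu : 0 < u) (hv : 0 < v) (hu' : 0 < u')
    (hv' : 0 < v') (h : cosLaw u v l = κ * cosLaw u' v' l') :
    (u ^ 2 + v ^ 2 - l ^ 2) * (u' * v') = κ * (u' ^ 2 + v' ^ 2 - l' ^ 2) * (u * v) := by
  unfold cosLaw at h
  field_simp at h
  linear_combination h

/-! ### Equators with zero sum -/

namespace OctahedronMetric

/-- Eliminating one side between the zero sum and the product relation leaves a quadratic expression
that factors, forcing two sides to agree. -/
theorem EquatorZeroSum.symmetric_of_mul {w x y z : ℝ} (hw : 0 < w) (hx : 0 < x) (hz : 0 < z)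
    (h : EquatorZeroSum w x y z) (hm : w * y = x * z) : EquatorSymmetric w x y z := by
  unfold EquatorZeroSum at h
  rcases mul_eq_zero.1 h with h | h
  · rcases mul_eq_zero.1 h with h | h
    · have : (w + x) * (x - y) = 0 := by linear_combination x * h - hm
      have : x = y := by
        rcases mul_eq_zero.1 this with h0 | h0 <;> linarith
      exact Or.inr (Or.inr ⟨by linarith, this⟩)
    · have : (w - x) * (w - z) = 0 := by linear_combination w * h - hm
      rcases mul_eq_zero.1 this with h0 | h0
      · exact Or.inr (Or.inl ⟨by linarith, by linarith⟩)
      · exact Or.inr (Or.inr ⟨by linarith, by linarith⟩)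
  · have : (w + z) * (y - z) = 0 := by linear_combination hm - z * h
    have : y = z := by
      rcases mul_eq_zero.1 this with h0 | h0 <;> linarith
    exact Or.inr (Or.inl ⟨by linarith, this⟩)

/-- Taking square roots gives a vanishing signed sum of the sides; the quadrilateral inequalities
rule out all patterns except two plus and two minus signs. -/
theorem equatorZeroSum_of_sq_eq {w x y z κ κ' : ℝ} (hq : IsQuadrilateral w x y z)
    (hκ : κ = 1 ∨ κ = -1) (hκ' : κ' = 1 ∨ κ' = -1) (h : (w + κ * x) ^ 2 = (z + κ' * y) ^ 2) :
    EquatorZeroSum w x y z := by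
  obtain ⟨h1, h2, h3, h4⟩ := hq
  unfold EquatorZeroSum
  rw [mul_eq_zero, mul_eq_zero]
  rcases sq_eq_sq_iff_eq_or_eq_neg.1 h with h | h <;> rcases hκ with rfl | rfl <;>
    rcases hκ' with rfl | rfl <;>
    first
    | (exfalso; linarith)
    | (left; left; linarith)
    | (left; right; linarith)
    | (right; linarith)

/-- An equator whose neighbouring sides are pairwise equal or have a common product is symmetric as
soon as it has zero sum. -/
theorem EquatorZeroSum.symmetric_of_common_product {w x y z m : ℝ} (hw : 0 < w) (hx : 0 < x)
    (hy : 0 < y) (hz : 0 < z) (h : EquatorZeroSum w x y z) (h₁ : w = x ∨ w * x = m)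
    (h₂ : x = y ∨ x * y = m) (h₃ : z = y ∨ z * y = m) (h₄ : w = z ∨ w * z = m) :
    EquatorSymmetric w x y z := by
  have cancel : ∀ {s t u : ℝ}, 0 < s → s * t = m → s * u = m → t = u := fun hs h h' =>
    mul_left_cancel₀ hs.ne' (h.trans h'.symm)
  -- Two neighbouring alternatives of the same kind at a side make an opposite pair equal; mixed
  -- ones leave only wy = xz.
  have key : w = y ∨ x = z ∨ w * y = x * z := by
    rcases h₁ with h₁ | h₁ <;> rcases h₂ with h₂ | h₂
    · exact Or.inl (h₁.trans h₂)
    · rcases h₃ with h₃ | h₃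
      · right; right; rw [h₁, h₃]
      · exact Or.inr (Or.inl (cancel hy (by linarith) (by linarith)))
    · rcases h₄ with h₄ | h₄
      · right; right; rw [h₂, h₄]; ring
      · exact Or.inr (Or.inl (cancel hw h₁ h₄))
    · exact Or.inl (cancel hx (by linarith) h₂)
  rcases key with hk | hk | hk
  · subst hk
    have hs : x = z ∨ 2 * w = x + z := by
      unfold EquatorZeroSum at h
      rcases mul_eq_zero.1 h with h | h
      · rcases mul_eq_zero.1 h with h | h
        · left; linarith
        · right; linarith
      · left; linarith
    rcases hs with hs | hs
    · exact Or.inl ⟨rfl, hs⟩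
    · rcases h₂ with h₂ | h₂
      · exact Or.inl ⟨rfl, by linarith⟩
      · rcases h₃ with h₃ | h₃
        · exact Or.inl ⟨rfl, by linarith⟩
        · exact Or.inl ⟨rfl, cancel hw (by linarith) (by linarith)⟩
  · subst hk
    have hs : w = y ∨ 2 * x = w + y := by
      unfold EquatorZeroSum at h
      rcases mul_eq_zero.1 h with h | h
      · rcases mul_eq_zero.1 h with h | h
        · left; linarith
        · right; linarith
      · left; linarith
    rcases hs with hs | hs
    · exact Or.inl ⟨hs, rfl⟩
    · rcases h₁ with h₁ | h₁
      · exact Or.inl ⟨by linarith, rfl⟩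
      · rcases h₂ with h₂ | h₂
        · exact Or.inl ⟨by linarith, rfl⟩
        · exact Or.inl ⟨cancel hx (by linarith) h₂, rfl⟩
  · exact h.symmetric_of_mul hw hx hz hk

end OctahedronMetric

/-! ### Type A when the three fields do not all coincide -/

namespace OctahedronMetric

section Areas

variable {K : OctahedronMetric} {κ : ℝ}

theorem fourArea_of_deltoid₁ (h : K.link₁.Deltoid κ) :
    fourArea K.p K.q K.c * K.r = fourArea K.q K.r K.f * K.p ∧
      fourArea K.s K.p K.g * K.r = fourArea K.r K.s K.h * K.p :=
  VertexFigure.fourArea_of_deltoid h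

theorem fourArea_of_deltoid_rotate₁ (h : K.link₁.rotate.Deltoid κ) :
    fourArea K.q K.r K.f * K.s = fourArea K.r K.s K.h * K.q ∧
      fourArea K.p K.q K.c * K.s = fourArea K.s K.p K.g * K.q :=
  VertexFigure.fourArea_of_deltoid_rotate h

theorem fourArea_of_deltoid₂ (h : K.link₂.Deltoid κ) :
    fourArea K.p K.q K.c * K.g = fourArea K.s K.p K.g * K.c ∧
      fourArea K.b K.a K.c * K.g = fourArea K.d K.b K.g * K.c := by
  have := VertexFigure.fourArea_of_deltoid h
  rwa [fourArea_rot' K.p, fourArea_rot K.s, fourArea_reverse K.d, fourArea_swap' K.b] at this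

theorem fourArea_of_deltoid₃ (h : K.link₃.Deltoid κ) :
    fourArea K.p K.q K.c * K.f = fourArea K.q K.r K.f * K.c ∧
      fourArea K.b K.a K.c * K.f = fourArea K.a K.e K.f * K.c := by
  have := VertexFigure.fourArea_of_deltoid h
  rwa [fourArea_reverse K.p, fourArea_swap' K.q, fourArea_rot' K.a, fourArea_rot K.b] at this

theorem fourArea_of_deltoid₄ (h : K.link₄.Deltoid κ) :
    fourArea K.q K.r K.f * K.h = fourArea K.r K.s K.h * K.f ∧
      fourArea K.a K.e K.f * K.h = fourArea K.e K.d K.h * K.f := by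
  have := VertexFigure.fourArea_of_deltoid h
  rwa [fourArea_reverse K.q, fourArea_swap' K.r, fourArea_rot' K.e, fourArea_rot K.a] at this

theorem fourArea_of_deltoid₅ (h : K.link₅.Deltoid κ) :
    fourArea K.s K.p K.g * K.h = fourArea K.r K.s K.h * K.g ∧
      fourArea K.d K.b K.g * K.h = fourArea K.e K.d K.h * K.g := by
  have := VertexFigure.fourArea_of_deltoid h
  rwa [fourArea_rot' K.s, fourArea_rot K.r, fourArea_reverse K.e, fourArea_swap' K.d] at this

theorem fourArea_of_isogram₁ (h : K.link₁.Isogram κ) :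
    fourArea K.p K.q K.c * (K.r * K.s) = fourArea K.r K.s K.h * (K.p * K.q) ∧
      fourArea K.q K.r K.f * (K.s * K.p) = fourArea K.s K.p K.g * (K.q * K.r) :=
  VertexFigure.fourArea_of_isogram h

theorem fourArea_of_isogram₆ (h : K.link₆.Isogram κ) :
    fourArea K.b K.a K.c * (K.e * K.d) = fourArea K.e K.d K.h * (K.b * K.a) ∧
      fourArea K.a K.e K.f * (K.d * K.b) = fourArea K.d K.b K.g * (K.a * K.e) :=
  VertexFigure.fourArea_of_isogram h

theorem fourArea_of_isogram₂ (h : K.link₂.Isogram κ) :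
    fourArea K.p K.q K.c * (K.g * K.b) = fourArea K.d K.b K.g * (K.c * K.p) ∧
      fourArea K.s K.p K.g * (K.b * K.c) = fourArea K.b K.a K.c * (K.p * K.g) := by
  have := VertexFigure.fourArea_of_isogram h
  rwa [fourArea_rot' K.p, fourArea_rot K.s, fourArea_reverse K.d, fourArea_swap' K.b] at this

theorem fourArea_of_isogram₃ (h : K.link₃.Isogram κ) :
    fourArea K.p K.q K.c * (K.f * K.a) = fourArea K.a K.e K.f * (K.c * K.q) ∧
      fourArea K.q K.r K.f * (K.a * K.c) = fourArea K.b K.a K.c * (K.q * K.f) := by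
  have := VertexFigure.fourArea_of_isogram h
  rwa [fourArea_reverse K.p, fourArea_swap' K.q, fourArea_rot' K.a, fourArea_rot K.b] at this

theorem fourArea_of_isogram₄ (h : K.link₄.Isogram κ) :
    fourArea K.q K.r K.f * (K.h * K.e) = fourArea K.e K.d K.h * (K.f * K.r) ∧
      fourArea K.r K.s K.h * (K.e * K.f) = fourArea K.a K.e K.f * (K.r * K.h) := by
  have := VertexFigure.fourArea_of_isogram h
  rwa [fourArea_reverse K.q, fourArea_swap' K.r, fourArea_rot' K.e, fourArea_rot K.a] at this

theorem fourArea_of_isogram₅ (h : K.link₅.Isogram κ) :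
    fourArea K.s K.p K.g * (K.h * K.d) = fourArea K.e K.d K.h * (K.g * K.s) ∧
      fourArea K.r K.s K.h * (K.d * K.g) = fourArea K.d K.b K.g * (K.s * K.h) := by
  have := VertexFigure.fourArea_of_isogram h
  rwa [fourArea_rot' K.s, fourArea_rot K.r, fourArea_reverse K.e, fourArea_swap' K.d] at this

end Areas

/-- Two adjacent pairs of faces with equal or supplementary angles at a common vertex, the outer
edges being equal crosswise. -/
theorem eq_or_mul_eq_of_cosLaw {u v p r q s κ : ℝ} (hu : 0 < u) (hv : 0 < v) (hq : 0 < q)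
    (hs : 0 < s) (hκ : κ = 1 ∨ κ = -1) (h₁ : cosLaw u q p = κ * cosLaw q v r)
    (h₂ : cosLaw s u r = κ * cosLaw v s p) :
    u = v ∨ u * v = |(q ^ 2 + s ^ 2 - p ^ 2 - r ^ 2) / 2| := by
  have e1 : (u ^ 2 + q ^ 2 - p ^ 2) * v = κ * (q ^ 2 + v ^ 2 - r ^ 2) * u :=
    mul_right_cancel₀ hq.ne' (by linear_combination cosLaw_cross_mul hu hq hq hv h₁)
  have e2 : (s ^ 2 + u ^ 2 - r ^ 2) * v = κ * (v ^ 2 + s ^ 2 - p ^ 2) * u :=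
    mul_right_cancel₀ hs.ne' (by linear_combination cosLaw_cross_mul hs hu hv hs h₂)
  have hκ2 : κ ^ 2 = 1 := by rcases hκ with h | h <;> rw [h] <;> norm_num
  -- Adding the two cleared equations gives an expression divisible by u − κv. The absolute value in
  -- the conclusion absorbs κ, so the four vertices of an equator can share one product.
  have e3 : (u - κ * v) * (u * (κ * v) - (q ^ 2 + s ^ 2 - p ^ 2 - r ^ 2) / 2) = 0 := by
    linear_combination (κ / 2) * (e1 + e2) + (u / 2) * (q ^ 2 + s ^ 2 - p ^ 2 - r ^ 2) * hκ2
  rcases mul_eq_zero.1 e3 with h | h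
  · left
    rcases hκ with rfl | rfl <;> linarith
  · right
    have : (q ^ 2 + s ^ 2 - p ^ 2 - r ^ 2) / 2 = κ * (u * v) := by linarith
    have hp := mul_pos hu hv
    rw [this, abs_mul, abs_of_pos hp]
    rcases hκ with rfl | rfl <;> simp

variable {K : OctahedronMetric} {L : Type*} [Field L] [Algebra ℝ L] {x y z : L}

/-- The equator avoiding `v₁` and `v₆` is symmetric unless all three diagonals generate the same
field. -/
theorem GenericFlex.equatorSymmetric (h : K.GenericFlex x y z)
    (hne : ¬ (ℝ⟮x⟯ = ℝ⟮z⟯ ∧ ℝ⟮y⟯ = ℝ⟮z⟯)) : EquatorSymmetric K.c K.f K.h K.g := by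
  obtain ⟨ha, hb, hc, hd, he, hf, hg, hh, hp, hq, hr, hs⟩ := K.pos
  have hx := h.trans_x
  have hy := h.trans_y
  have hz := h.trans_z
  have mem_eq : ∀ {u v : L}, u ∈ ℝ⟮v⟯ → v ∈ ℝ⟮u⟯ → ℝ⟮u⟯ = ℝ⟮v⟯ := fun h1 h2 =>
    le_antisymm (adjoin_simple_le_iff.2 h1) (adjoin_simple_le_iff.2 h2)
  by_cases hxz : x ∈ ℝ⟮z⟯
  swap
  -- With x not rational in z, the links of v₃ and v₅, seen from the z-side, have the same pair of
  -- equatorial edges.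
  · have key : (K.f = K.h ∧ K.c = K.g) ∨ (K.f = K.g ∧ K.c = K.h) := by
      by_cases hzx : z ∈ ℝ⟮x⟯
      · obtain ⟨_, _, _, _, hw, _⟩ :=
          h.flex₃.rotate.pair_eq_of_mem_not_mem h.flex₅.rotate hz hx hzx hxz
        exact hw
      · exact h.flex₃.rotate.pair_eq_of_not_mem h.flex₅.rotate hz hx hzx hxz
    rcases key with ⟨h1, h2⟩ | ⟨h1, h2⟩
    · exact Or.inr (Or.inr ⟨h2, h1⟩)
    · exact Or.inl ⟨h2, h1⟩
  by_cases hyz : y ∈ ℝ⟮z⟯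
  swap
  · have key : (K.g = K.h ∧ K.c = K.f) ∨ (K.g = K.f ∧ K.c = K.h) := by
      by_cases hzy : z ∈ ℝ⟮y⟯
      · obtain ⟨_, _, _, _, hw, _⟩ :=
          h.flex₂.rotate.pair_eq_of_mem_not_mem h.flex₄.rotate hz hy hzy hyz
        exact hw
      · exact h.flex₂.rotate.pair_eq_of_not_mem h.flex₄.rotate hz hy hzy hyz
    rcases key with ⟨h1, h2⟩ | ⟨h1, h2⟩
    · exact Or.inr (Or.inl ⟨h2, h1.symm⟩)
    · exact Or.inl ⟨h2, h1.symm⟩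
  have hsum : EquatorZeroSum K.c K.f K.h K.g := by
    by_cases hzx : z ∈ ℝ⟮x⟯
    · obtain ⟨σ, τ, σ', τ', k, hσ, -, hσ', -, -, -, -, -, he, -⟩ :=
        h.flex₃.bilinear_of_mem_mem h.flex₅ hx hz hxz hzx
      exact equatorZeroSum_of_sq_eq h.quad_z hσ hσ' he
    · obtain ⟨κ, κ', hκ, hκ', -, he⟩ := h.flex₃.pair_eq_of_mem_not_mem h.flex₅ hx hz hxz hzx
      exact equatorZeroSum_of_sq_eq h.quad_z hκ.1 hκ'.1 he
  have s1 := K.triangle_pqc.fourArea_pos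
  have s2 := K.triangle_qrf.fourArea_pos
  have s3 := K.triangle_rsh.fourArea_pos
  have s4 := K.triangle_spg.fourArea_pos
  have s5 := K.triangle_bac.fourArea_pos
  have s6 := K.triangle_aef.fourArea_pos
  have s7 := K.triangle_edh.fourArea_pos
  have s8 := K.triangle_dbg.fourArea_pos
  by_cases hxy : x ∈ ℝ⟮y⟯ <;> by_cases hyx : y ∈ ℝ⟮x⟯
  -- Here ℝ(x) = ℝ(y) is strictly inside ℝ(z): deltoids at v₂, …, v₅ and isograms at v₁, v₆.
  -- Multiplying the area relations at v₁ and v₆ gives c² = h² and f² = g².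
  · have hzx : z ∉ ℝ⟮x⟯ := fun h1 =>
      hne ⟨mem_eq hxz h1, mem_eq hyz (adjoin_simple_mem_trans h1 hxy)⟩
    have hzy : z ∉ ℝ⟮y⟯ := fun h1 => hzx (adjoin_simple_mem_trans h1 hyx)
    obtain ⟨κ₃, κ₅, d3, d5, hw, -⟩ := h.flex₃.pair_eq_of_mem_not_mem h.flex₅ hx hz hxz hzx
    obtain ⟨κ₂, κ₄, d2, d4, hw', -⟩ := h.flex₂.pair_eq_of_mem_not_mem h.flex₄ hy hz hyz hzy
    obtain ⟨ε₁, i1⟩ := h.flex₁.isogram_of_mem_mem hx hy hxy hyx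
    obtain ⟨ε₆, i6⟩ := h.flex₆.isogram_of_mem_mem hx hy hxy hyx
    obtain ⟨a3, a3'⟩ := fourArea_of_deltoid₃ d3
    obtain ⟨a5, a5'⟩ := fourArea_of_deltoid₅ d5
    obtain ⟨a2, a2'⟩ := fourArea_of_deltoid₂ d2
    obtain ⟨b1, b1'⟩ := fourArea_of_isogram₁ i1
    obtain ⟨b6, b6'⟩ := fourArea_of_isogram₆ i6
    have hqa : K.q * K.a = K.s * K.d := by
      rcases hw with ⟨h1, h2⟩ | ⟨h1, h2⟩
      · exact congrArg₂ (· * ·) h1 h2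
      · exact (congrArg₂ (· * ·) h1 h2).trans (mul_comm _ _)
    have hpb : K.p * K.b = K.r * K.e := by
      rcases hw' with ⟨h1, h2⟩ | ⟨h1, h2⟩
      · exact congrArg₂ (· * ·) h1 h2
      · exact (congrArg₂ (· * ·) h1 h2).trans (mul_comm _ _)
    set S₁ := fourArea K.p K.q K.c
    set S₂ := fourArea K.q K.r K.f
    set S₃ := fourArea K.r K.s K.h
    set S₄ := fourArea K.s K.p K.g
    set S₅ := fourArea K.b K.a K.c
    set S₆ := fourArea K.a K.e K.f
    set S₇ := fourArea K.e K.d K.h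
    set S₈ := fourArea K.d K.b K.g
    have c3 : S₁ * K.h = S₃ * K.c :=
      mul_right_cancel₀ hg.ne' (by linear_combination K.h * a2 + K.c * a5)
    have c7 : S₅ * K.h = S₇ * K.c :=
      mul_right_cancel₀ hg.ne' (by linear_combination K.h * a2' + K.c * a5')
    have f1 : K.c * (K.r * K.s) = K.h * (K.p * K.q) :=
      mul_left_cancel₀ s1.ne' (by linear_combination K.c * b1 - K.p * K.q * c3)
    have f2 : K.c * (K.e * K.d) = K.h * (K.b * K.a) :=
      mul_left_cancel₀ s5.ne' (by linear_combination K.c * b6 - K.b * K.a * c7)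
    have f3 : K.f * (K.s * K.p) = K.g * (K.q * K.r) :=
      mul_left_cancel₀ s1.ne' (by
        linear_combination K.s * K.p * a3 + K.c * b1' - K.q * K.r * a2)
    have f4 : K.f * (K.d * K.b) = K.g * (K.a * K.e) :=
      mul_left_cancel₀ s5.ne' (by
        linear_combination K.d * K.b * a3' + K.c * b6' - K.a * K.e * a2')
    have hch : K.c = K.h := by
      refine (sq_eq_sq₀ hc.le hh.le).1 ?_
      refine mul_right_cancel₀ (mul_pos (mul_pos hr he) (mul_pos hs hd)).ne' ?_
      linear_combination K.c * K.e * K.d * f1 + K.h * K.p * K.q * f2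
        + K.h ^ 2 * (K.q * K.a * hpb + K.r * K.e * hqa)
    have hfg : K.f = K.g := by
      refine (sq_eq_sq₀ hf.le hg.le).1 ?_
      refine mul_right_cancel₀ (mul_pos (mul_pos hp hb) (mul_pos hs hd)).ne' ?_
      linear_combination K.f * K.d * K.b * f3 + K.g * K.q * K.r * f4
        - K.g ^ 2 * (K.q * K.a * hpb) + K.g ^ 2 * (K.p * K.b * hqa)
    exact Or.inl ⟨hch, hfg⟩
  -- The deltoids at v₁, v₃, v₅ give c/f = p/r = g/h, hence ch = fg.
  · have hzx : z ∉ ℝ⟮x⟯ := fun h1 => hyx (adjoin_simple_mem_trans hyz h1)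
    obtain ⟨κ₃, d3⟩ := h.flex₃.deltoid_of_mem_not_mem hx hz hxz hzx
    obtain ⟨κ₅, d5⟩ := h.flex₅.deltoid_of_mem_not_mem hx hz hxz hzx
    obtain ⟨κ₁, d1⟩ := h.flex₁.deltoid_of_mem_not_mem hx hy hxy hyx
    obtain ⟨a3, -⟩ := fourArea_of_deltoid₃ d3
    obtain ⟨a5, -⟩ := fourArea_of_deltoid₅ d5
    obtain ⟨a1, a1'⟩ := fourArea_of_deltoid₁ d1
    refine hsum.symmetric_of_mul hc hf hg ?_
    have e1 : K.c * K.r = K.f * K.p :=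
      mul_left_cancel₀ s1.ne' (by linear_combination K.c * a1 - K.p * a3)
    have e2 : K.g * K.r = K.h * K.p :=
      mul_left_cancel₀ s4.ne' (by linear_combination K.g * a1' - K.p * a5)
    refine mul_right_cancel₀ (mul_pos hp hr).ne' ?_
    linear_combination K.h * K.p * e1 - K.f * K.p * e2
  · have hzy : z ∉ ℝ⟮y⟯ := fun h1 => hxy (adjoin_simple_mem_trans hxz h1)
    obtain ⟨κ₂, d2⟩ := h.flex₂.deltoid_of_mem_not_mem hy hz hyz hzy
    obtain ⟨κ₄, d4⟩ := h.flex₄.deltoid_of_mem_not_mem hy hz hyz hzy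
    obtain ⟨κ₁, d1⟩ := h.flex₁.rotate.deltoid_of_mem_not_mem hy hx hyx hxy
    obtain ⟨a2, -⟩ := fourArea_of_deltoid₂ d2
    obtain ⟨a4, -⟩ := fourArea_of_deltoid₄ d4
    obtain ⟨a1, a1'⟩ := fourArea_of_deltoid_rotate₁ d1
    refine hsum.symmetric_of_mul hc hf hg ?_
    have e1 : K.c * K.s = K.g * K.q :=
      mul_left_cancel₀ s1.ne' (by linear_combination K.c * a1' - K.q * a2)
    have e2 : K.f * K.s = K.h * K.q :=
      mul_left_cancel₀ s2.ne' (by linear_combination K.f * a1 - K.q * a4)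
    refine mul_right_cancel₀ (mul_pos hq hs).ne' ?_
    linear_combination K.h * K.q * e1 - K.g * K.q * e2
  -- With x and y mutually irrational, v₁ and v₆ match edges too, so edges at v₁ equal the opposite
  -- edges at v₆. The deltoids at v₂, …, v₅ then make neighbouring equatorial edges equal or of one
  -- common product.
  · have hzx : z ∉ ℝ⟮x⟯ := fun h1 => hyx (adjoin_simple_mem_trans hyz h1)
    have hzy : z ∉ ℝ⟮y⟯ := fun h1 => hxy (adjoin_simple_mem_trans hxz h1)
    obtain ⟨κ₃, κ₅, d3, d5, hw, -⟩ := h.flex₃.pair_eq_of_mem_not_mem h.flex₅ hx hz hxz hzx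
    obtain ⟨κ₂, κ₄, d2, d4, hw', -⟩ := h.flex₂.pair_eq_of_mem_not_mem h.flex₄ hy hz hyz hzy
    have hv := h.flex₁.pair_eq_of_not_mem h.flex₆ hx hy hxy hyx
    have hv' := h.flex₁.rotate.pair_eq_of_not_mem h.flex₆.rotate hy hx hyx hxy
    have w1 : (K.q = K.s ∧ K.a = K.d) ∨ (K.q = K.d ∧ K.a = K.s) := hw
    have w2 : (K.p = K.r ∧ K.b = K.e) ∨ (K.p = K.e ∧ K.b = K.r) := hw'
    have w3 : (K.q = K.a ∧ K.s = K.d) ∨ (K.q = K.d ∧ K.s = K.a) := hv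
    have w4 : (K.r = K.e ∧ K.p = K.b) ∨ (K.r = K.b ∧ K.p = K.e) := hv'
    have hqd : K.d = K.q ∧ K.a = K.s := by
      rcases w1 with ⟨h1, h2⟩ | ⟨h1, h2⟩
      · rcases w3 with ⟨h3, h4⟩ | ⟨h3, h4⟩ <;> constructor <;> linarith
      · exact ⟨h1.symm, h2⟩
    have hpe : K.e = K.p ∧ K.b = K.r := by
      rcases w2 with ⟨h1, h2⟩ | ⟨h1, h2⟩
      · rcases w4 with ⟨h3, h4⟩ | ⟨h3, h4⟩ <;> constructor <;> linarith
      · exact ⟨h1.symm, h2⟩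
    obtain ⟨k3, α3, δ3⟩ := d3
    obtain ⟨k5, α5, δ5⟩ := d5
    obtain ⟨k2, α2, δ2⟩ := d2
    obtain ⟨k4, α4, δ4⟩ := d4
    simp only [link₂, link₃, link₄, link₅, VertexFigure.ofLengths, hqd.1, hqd.2, hpe.1, hpe.2]
      at α3 δ3 α5 δ5 α2 δ2 α4 δ4
    have m3 := eq_or_mul_eq_of_cosLaw hc hf hq hs k3 α3 δ3
    have m5 := eq_or_mul_eq_of_cosLaw hg hh hs hq k5 α5 δ5
    have m2 := eq_or_mul_eq_of_cosLaw hc hg hp hr k2 α2 δ2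
    have m4 := eq_or_mul_eq_of_cosLaw hf hh hr hp k4 α4 δ4
    have n5 : (K.s ^ 2 + K.q ^ 2 - K.p ^ 2 - K.r ^ 2) / 2 =
      (K.q ^ 2 + K.s ^ 2 - K.p ^ 2 - K.r ^ 2) / 2 := by ring
    have n2 : (K.p ^ 2 + K.r ^ 2 - K.q ^ 2 - K.s ^ 2) / 2 =
      -((K.q ^ 2 + K.s ^ 2 - K.p ^ 2 - K.r ^ 2) / 2) := by ring
    have n4 : (K.r ^ 2 + K.p ^ 2 - K.q ^ 2 - K.s ^ 2) / 2 =
      -((K.q ^ 2 + K.s ^ 2 - K.p ^ 2 - K.r ^ 2) / 2) := by ring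
    rw [n5] at m5
    rw [n2, abs_neg] at m2
    rw [n4, abs_neg] at m4
    exact hsum.symmetric_of_common_product hc hf hh hg m3 m4 m5 m2

theorem EquatorSymmetric.swap {w x y z : ℝ} (h : EquatorSymmetric w x y z) :
    EquatorSymmetric x w z y := by
  rcases h with ⟨h1, h2⟩ | ⟨h1, h2⟩ | ⟨h1, h2⟩
  · exact Or.inl ⟨h2, h1⟩
  · exact Or.inr (Or.inl ⟨h1.symm, h2.symm⟩)
  · exact Or.inr (Or.inr ⟨h2, h1⟩)

/-- Failure of the three fields to coincide is invariant under cyclic renaming, so one equator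
argument serves all three. -/
theorem typeA_of_not_adjoin_eq (h : K.GenericFlex x y z) (h' : K.rotate.GenericFlex y z x)
    (h'' : K.rotate.rotate.GenericFlex z x y) (hne : ¬ (ℝ⟮x⟯ = ℝ⟮z⟯ ∧ ℝ⟮y⟯ = ℝ⟮z⟯)) :
    K.TypeA := by
  refine ⟨h.equatorSymmetric hne, ?_, ?_⟩
  · have : EquatorSymmetric K.p K.b K.e K.r :=
      h''.equatorSymmetric fun ⟨h1, h2⟩ => hne ⟨h2.trans h1.symm, h1.symm⟩
    exact this.swap
  · have : EquatorSymmetric K.q K.s K.d K.a :=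
      h'.equatorSymmetric fun ⟨h1, h2⟩ => hne ⟨h2.symm, h1.trans h2.symm⟩
    exact this.swap

end OctahedronMetric

/-! ### Signs and the polynomial B when all three fields coincide -/

/-- Three bilinear relations between pairs of three transcendental quantities are compatible only if
the product of their constants is negative. -/
theorem bilinear_constants_mul_neg {L : Type*} [Field L] [Algebra ℝ L] {x y z : L}
    (hz : Transcendental ℝ z) {x₁ z₁ x₂ y₂ y₃ z₃ k₁ k₂ k₃ : ℝ} (hk₂ : k₂ ≠ 0) (hk₃ : k₃ ≠ 0)
    (e₁ : (x - algebraMap ℝ L x₁) * (z - algebraMap ℝ L z₁) = algebraMap ℝ L k₁)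
    (e₂ : (x - algebraMap ℝ L x₂) * (y - algebraMap ℝ L y₂) = algebraMap ℝ L k₂)
    (e₃ : (y - algebraMap ℝ L y₃) * (z - algebraMap ℝ L z₃) = algebraMap ℝ L k₃) :
    k₁ * k₂ * k₃ < 0 := by
  -- The first and third relations express x and y as Möbius functions of z; substituted into the
  -- second, they give a quadratic in z whose coefficients vanish.
  have key : ((x₁ - x₂) * (y₃ - y₂) - k₂ = 0) ∧
      (k₁ * (y₃ - y₂) + k₃ * (x₁ - x₂) - ((x₁ - x₂) * (y₃ - y₂) - k₂) * (z₁ + z₃) = 0) ∧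
      (((x₁ - x₂) * (y₃ - y₂) - k₂) * (z₁ * z₃) - k₁ * (y₃ - y₂) * z₃ - k₃ * (x₁ - x₂) * z₁
        + k₁ * k₃ = 0) := by
    apply hz.quadratic
    simp only [map_sub, map_mul, map_add]
    set ι := algebraMap ℝ L
    linear_combination (z - ι z₁) * (z - ι z₃) * e₂ - (z - ι z₃) * (y - ι y₂) * e₁
      - (ι k₁ + (ι x₁ - ι x₂) * (z - ι z₁)) * e₃
  obtain ⟨h1, h2, -⟩ := key
  rw [h1] at h2
  have hk2 : k₂ = (x₁ - x₂) * (y₃ - y₂) := by linarith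
  have hx : x₁ - x₂ ≠ 0 := by intro h; rw [h] at hk2; exact hk₂ (by simpa using hk2)
  have e' : k₁ * (y₃ - y₂) = -(k₃ * (x₁ - x₂)) := by linarith
  have hprod : k₁ * k₂ * k₃ = -(k₃ * (x₁ - x₂)) ^ 2 := by
    rw [hk2]
    linear_combination k₃ * (x₁ - x₂) * e'
  rw [hprod]
  have : 0 < (k₃ * (x₁ - x₂)) ^ 2 := by positivity
  linarith

/-- Each squared equation is a zero sum with two plus and two minus signs. If they are different
sums, adding and subtracting them gives w = y and x = z; so they are the same sum, carrying both σ
and ρ. -/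
theorem signed_sum_eq_zero {w x y z σ ρ σ' ρ' : ℝ} (hw : 0 < w) (hx : 0 < x) (hy : 0 < y)
    (hz : 0 < z) (hq : IsQuadrilateral w x y z) (hne : ¬ (w = y ∧ x = z)) (hσ : σ = 1 ∨ σ = -1)
    (hρ : ρ = 1 ∨ ρ = -1) (hσ' : σ' = 1 ∨ σ' = -1) (hρ' : ρ' = 1 ∨ ρ' = -1)
    (h : (w + σ * x) ^ 2 = (z + σ' * y) ^ 2) (h' : (w + ρ * z) ^ 2 = (x + ρ' * y) ^ 2) :
    w + σ * x + ρ * z + σ * ρ * y = 0 := by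
  obtain ⟨h1, h2, h3, h4⟩ := hq
  rcases sq_eq_sq_iff_eq_or_eq_neg.1 h with h | h <;>
    rcases sq_eq_sq_iff_eq_or_eq_neg.1 h' with h' | h' <;> rcases hσ with rfl | rfl <;>
    rcases hσ' with rfl | rfl <;> rcases hρ with rfl | rfl <;> rcases hρ' with rfl | rfl <;>
    first
    | linarith
    | exact absurd ⟨by linarith, by linarith⟩ hne

/-- Signed edge lengths with vanishing equatorial sums, subject to the proportionality relations and
to the equality of opposite angles at two vertices, annihilate the polynomial `B`. -/
theorem signed_B_eq_zero {a b c d e f g h p q r s : ℝ} (ha : a ≠ 0) (hb : b ≠ 0) (hc : c ≠ 0)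
    (hh : h ≠ 0) (hs : s ≠ 0) (hrb : r + b ≠ 0)
    (sx : q + s + d + a = 0) (sy : p + r + e + b = 0) (sz : c + f + h + g = 0)
    (r₁ : b * h * q = -(c * d * r)) (r₂ : r * g * a = -(s * f * b)) (r₃ : a * p * h = -(c * s * e))
    (i₆ : (b ^ 2 + a ^ 2 - c ^ 2) * (e * d) = (e ^ 2 + d ^ 2 - h ^ 2) * (b * a))
    (i₂ : (p ^ 2 + g ^ 2 - s ^ 2) * (b * c) = (b ^ 2 + c ^ 2 - a ^ 2) * (p * g)) :
    a * b * c * (h ^ 2 + s ^ 2 + r ^ 2) + h * s * r * (a ^ 2 + b ^ 2 + c ^ 2)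
      - c * s * b * (h ^ 2 + r ^ 2 - s ^ 2) - h * r * a * (b ^ 2 + c ^ 2 - a ^ 2)
      - a * h * b * (s ^ 2 + r ^ 2 - h ^ 2) - s * r * c * (a ^ 2 + b ^ 2 - c ^ 2)
      - c * r * a * (s ^ 2 + h ^ 2 - r ^ 2) - s * h * b * (a ^ 2 + c ^ 2 - b ^ 2) = 0 := by
  -- The zero sums and ratios determine p, e, d, g up to the factors U, V, T. These may vanish, so
  -- the angle equations are multiplied by them instead of divided.
  set U := c * s - a * h with hU
  set V := c * r - b * h with hV
  set T := r * a - s * b with hT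
  have hp : p * U = -((r + b) * (c * s)) := by rw [hU]; linear_combination c * s * sy - r₃
  have he : e * U = (r + b) * (a * h) := by rw [hU]; linear_combination r₃ - a * h * sy
  have hd : d * V = (a + s) * (b * h) := by rw [hV]; linear_combination r₁ - b * h * sx
  have hg : g * T = (c + h) * (s * b) := by rw [hT]; linear_combination r₂ - s * b * sz
  have j₆ : (a * b * c - a * b * h + a * c * r + b * c * s) *
      (a * b * c * (h ^ 2 + s ^ 2 + r ^ 2) + h * s * r * (a ^ 2 + b ^ 2 + c ^ 2)
      - c * s * b * (h ^ 2 + r ^ 2 - s ^ 2) - h * r * a * (b ^ 2 + c ^ 2 - a ^ 2)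
      - a * h * b * (s ^ 2 + r ^ 2 - h ^ 2) - s * r * c * (a ^ 2 + b ^ 2 - c ^ 2)
      - c * r * a * (s ^ 2 + h ^ 2 - r ^ 2) - s * h * b * (a ^ 2 + c ^ 2 - b ^ 2)) = 0 := by
    have key : (b ^ 2 + a ^ 2 - c ^ 2) * ((e * U) * (d * V)) * (U * V) =
        ((e * U) ^ 2 * V ^ 2 + (d * V) ^ 2 * U ^ 2 - h ^ 2 * U ^ 2 * V ^ 2) * (b * a) := by
      linear_combination U ^ 2 * V ^ 2 * i₆
    rw [he, hd] at key
    have hne : a * b * h ^ 2 ≠ 0 := mul_ne_zero (mul_ne_zero ha hb) (pow_ne_zero 2 hh)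
    refine (mul_eq_zero.1 (?_ : a * b * h ^ 2 * _ = 0)).resolve_left hne
    rw [hU, hV] at key
    linear_combination -key
  have j₂ : (a * b * c + a * b * h + a * c * r - b * c * s) *
      (a * b * c * (h ^ 2 + s ^ 2 + r ^ 2) + h * s * r * (a ^ 2 + b ^ 2 + c ^ 2)
      - c * s * b * (h ^ 2 + r ^ 2 - s ^ 2) - h * r * a * (b ^ 2 + c ^ 2 - a ^ 2)
      - a * h * b * (s ^ 2 + r ^ 2 - h ^ 2) - s * r * c * (a ^ 2 + b ^ 2 - c ^ 2)
      - c * r * a * (s ^ 2 + h ^ 2 - r ^ 2) - s * h * b * (a ^ 2 + c ^ 2 - b ^ 2)) = 0 := by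
    have key : ((p * U) ^ 2 * T ^ 2 + (g * T) ^ 2 * U ^ 2 - s ^ 2 * U ^ 2 * T ^ 2) * (b * c) =
        (b ^ 2 + c ^ 2 - a ^ 2) * ((p * U) * (g * T)) * (U * T) := by
      linear_combination U ^ 2 * T ^ 2 * i₂
    rw [hp, hg] at key
    have hne : b * c * s ^ 2 ≠ 0 := mul_ne_zero (mul_ne_zero hb hc) (pow_ne_zero 2 hs)
    refine (mul_eq_zero.1 (?_ : b * c * s ^ 2 * _ = 0)).resolve_left hne
    rw [hU, hT] at key
    linear_combination key
  -- Either cofactor of the target polynomial could be zero; their sum cannot.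
  have hne : 2 * (a * c * (r + b)) ≠ 0 :=
    mul_ne_zero two_ne_zero (mul_ne_zero (mul_ne_zero ha hc) hrb)
  refine (mul_eq_zero.1 (?_ : 2 * (a * c * (r + b)) * _ = 0)).resolve_left hne
  linear_combination j₆ + j₂

theorem eq_of_sign_mul_pos {σ τ k : ℝ} (hσ : σ = 1 ∨ σ = -1) (hτ : τ = 1 ∨ τ = -1)
    (h : 0 < σ * k) (h' : 0 < τ * k) : σ = τ := by
  rcases hσ with rfl | rfl <;> rcases hτ with rfl | rfl <;> linarith

theorem sign_mul_sign {σ τ : ℝ} (hσ : σ = 1 ∨ σ = -1) (hτ : τ = 1 ∨ τ = -1) :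
    σ * τ = 1 ∨ σ * τ = -1 := by
  rcases hσ with rfl | rfl <;> rcases hτ with rfl | rfl <;> norm_num

namespace OctahedronMetric

/-- An equator in which opposite sides correspond to each other in a fixed ratio is symmetric if it
has zero sum. -/
theorem EquatorZeroSum.symmetric_of_ratio {w x y z : ℝ} (hw : 0 < w) (hy : 0 < y) (hz : 0 < z)
    (h : EquatorZeroSum w x y z) (hm : w * x = y * z) : EquatorSymmetric w x y z := by
  unfold EquatorZeroSum at h
  rcases mul_eq_zero.1 h with h | h
  · rcases mul_eq_zero.1 h with h | h
    · have : (w - y) * (w - z) = 0 := by linear_combination w * h - hm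
      rcases mul_eq_zero.1 this with h0 | h0
      · exact Or.inl ⟨by linarith, by linarith⟩
      · exact Or.inr (Or.inr ⟨by linarith, by linarith⟩)
    · have : (w + y) * (y - x) = 0 := by linear_combination y * h - hm
      have : x = y := by
        rcases mul_eq_zero.1 this with h0 | h0 <;> linarith
      exact Or.inr (Or.inr ⟨by linarith, this⟩)
  · have : (w + z) * (w - y) = 0 := by linear_combination w * h + hm
    have : w = y := by
      rcases mul_eq_zero.1 this with h0 | h0 <;> linarith
    exact Or.inl ⟨this, by linarith⟩

theorem EquatorZeroSum.shift {w x y z : ℝ} (h : EquatorZeroSum w x y z) :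
    EquatorZeroSum x y z w := by
  unfold EquatorZeroSum at h ⊢
  linear_combination h

theorem EquatorZeroSum.swap {w x y z : ℝ} (h : EquatorZeroSum w x y z) :
    EquatorZeroSum x w z y := by
  unfold EquatorZeroSum at h ⊢
  linear_combination h

theorem EquatorZeroSum.symmetric_of_ratio' {w x y z : ℝ} (hw : 0 < w) (hx : 0 < x) (hz : 0 < z)
    (h : EquatorZeroSum w x y z) (hm : x * y = w * z) : EquatorSymmetric w x y z := by
  rcases h.shift.symmetric_of_ratio hx hz hw (by linear_combination hm) with
    ⟨h1, h2⟩ | ⟨h1, h2⟩ | ⟨h1, h2⟩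
  · exact Or.inl ⟨h2.symm, h1⟩
  · exact Or.inr (Or.inr ⟨h2.symm, h1⟩)
  · exact Or.inr (Or.inl ⟨h1.symm, h2⟩)

/-- This is A/B = (A/C)(C/B): the areas of three faces cancel and a relation among edges remains. -/
theorem ratio_mul_eq {A B C m₁ m₂ m₃ n₁ n₂ n₃ : ℝ} (hB : 0 < B) (h₁ : A * m₁ = B * n₁)
    (h₂ : A * m₂ = C * n₂) (h₃ : C * m₃ = B * n₃) : n₁ * m₂ * m₃ = m₁ * n₂ * n₃ := by
  refine mul_left_cancel₀ hB.ne' ?_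
  linear_combination (-m₂ * m₃) * h₁ + m₁ * m₃ * h₂ + m₁ * n₂ * h₃

/-- The proportionality relations satisfied when all vertices have equal or supplementary opposite
angles. -/
theorem proportionality_of_isogram {K : OctahedronMetric} {ε₁ ε₂ ε₃ ε₄ ε₅ ε₆ : ℝ}
    (i₁ : K.link₁.Isogram ε₁) (i₂ : K.link₂.Isogram ε₂) (i₃ : K.link₃.Isogram ε₃)
    (i₄ : K.link₄.Isogram ε₄) (i₅ : K.link₅.Isogram ε₅) (i₆ : K.link₆.Isogram ε₆) :
    K.q * K.g * K.e = K.p * K.f * K.d ∧ K.b * K.h * K.q = K.c * K.d * K.r ∧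
      K.r * K.g * K.a = K.s * K.f * K.b ∧ K.a * K.p * K.h = K.c * K.s * K.e := by
  obtain ⟨ha, hb, hc, hd, he, hf, hg, hh, hp, hq, hr, hs⟩ := K.pos
  obtain ⟨a1, b1⟩ := fourArea_of_isogram₁ i₁
  obtain ⟨-, b2⟩ := fourArea_of_isogram₂ i₂
  obtain ⟨a3, b3⟩ := fourArea_of_isogram₃ i₃
  obtain ⟨a4, b4⟩ := fourArea_of_isogram₄ i₄
  obtain ⟨a5, -⟩ := fourArea_of_isogram₅ i₅
  obtain ⟨a6, -⟩ := fourArea_of_isogram₆ i₆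
  have s5 := K.triangle_bac.fourArea_pos
  have s6 := K.triangle_aef.fourArea_pos
  have s7 := K.triangle_edh.fourArea_pos
  refine ⟨?_, ?_, ?_, ?_⟩
  · refine mul_left_cancel₀ (mul_pos hr (mul_pos hs hh)).ne' ?_
    linear_combination -ratio_mul_eq s7 a4 b1 a5
  · refine mul_left_cancel₀ (mul_pos hf (mul_pos ha he)).ne' ?_
    linear_combination -ratio_mul_eq s7 a4 b3 a6
  · refine mul_left_cancel₀ (mul_pos hq (mul_pos hp hc)).ne' ?_
    linear_combination -ratio_mul_eq s5 b3 b1 b2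
  · refine mul_left_cancel₀ (mul_pos hq (mul_pos hr hf)).ne' ?_
    linear_combination -ratio_mul_eq s6 a3 a1 b4

/-- If opposite sides of some equator are equal, the zero sums and the proportionality relations
make all equators symmetric. -/
theorem typeA_of_opposite_eq {K : OctahedronMetric} (zz : EquatorZeroSum K.c K.f K.h K.g)
    (zy : EquatorZeroSum K.b K.p K.r K.e) (zx : EquatorZeroSum K.s K.q K.a K.d)
    (p1 : K.q * K.g * K.e = K.p * K.f * K.d) (p2 : K.b * K.h * K.q = K.c * K.d * K.r)
    (p3 : K.r * K.g * K.a = K.s * K.f * K.b)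
    (ho : (K.c = K.h ∧ K.f = K.g) ∨ (K.p = K.e ∧ K.r = K.b) ∨ (K.q = K.d ∧ K.a = K.s)) :
    K.TypeA := by
  obtain ⟨ha, hb, hc, hd, he, hf, hg, hh, hp, hq, hr, hs⟩ := K.pos
  rcases ho with oz | oy | ox
  · obtain ⟨o1, o2⟩ := oz
    have f2 : K.b * K.q = K.d * K.r :=
      mul_right_cancel₀ hh.ne' (by rw [o1] at p2; linear_combination p2)
    have f1 : K.q * K.e = K.p * K.d :=
      mul_right_cancel₀ hg.ne' (by rw [o2] at p1; linear_combination p1)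
    have f3 : K.r * K.a = K.s * K.b :=
      mul_right_cancel₀ hg.ne' (by rw [o2] at p3; linear_combination p3)
    refine ⟨Or.inl ⟨o1, o2⟩, zy.symmetric_of_ratio hb hr he ?_, zx.symmetric_of_ratio' hs hq hd ?_⟩
    · refine mul_left_cancel₀ (mul_pos hq hd).ne' ?_
      linear_combination K.p * K.d * f2 - K.d * K.r * f1
    · refine mul_left_cancel₀ (mul_pos hb hr).ne' ?_
      linear_combination K.r * K.a * f2 + K.d * K.r * f3
  · obtain ⟨o1, o2⟩ := oy
    have f1 : K.q * K.g = K.f * K.d :=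
      mul_right_cancel₀ he.ne' (by rw [o1] at p1; linear_combination p1)
    have f2 : K.h * K.q = K.c * K.d :=
      mul_right_cancel₀ hb.ne' (by rw [o2] at p2; linear_combination p2)
    have f3 : K.g * K.a = K.s * K.f :=
      mul_right_cancel₀ hb.ne' (by rw [o2] at p3; linear_combination p3)
    refine ⟨zz.symmetric_of_ratio' hc hf hg ?_, Or.inl ⟨o2.symm, o1⟩,
      zx.symmetric_of_ratio hs ha hd ?_⟩
    · refine mul_left_cancel₀ (mul_pos hq hd).ne' ?_
      linear_combination K.f * K.d * f2 - K.c * K.d * f1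
    · refine mul_left_cancel₀ (mul_pos hf hg).ne' ?_
      linear_combination K.s * K.f * f1 - K.f * K.d * f3
  · obtain ⟨o1, o2⟩ := ox
    have f1 : K.g * K.e = K.p * K.f :=
      mul_right_cancel₀ hd.ne' (by rw [o1] at p1; linear_combination p1)
    have f2 : K.b * K.h = K.c * K.r :=
      mul_right_cancel₀ hd.ne' (by rw [o1] at p2; linear_combination p2)
    have f3 : K.r * K.g = K.f * K.b :=
      mul_right_cancel₀ hs.ne' (by rw [o2] at p3; linear_combination p3)
    refine ⟨zz.symmetric_of_ratio hc hh hg ?_, zy.symmetric_of_ratio' hb hp he ?_,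
      Or.inl ⟨o2.symm, o1⟩⟩
    · refine mul_left_cancel₀ (mul_pos hr hb).ne' ?_
      linear_combination -K.f * K.b * f2 - K.h * K.b * f3
    · refine mul_left_cancel₀ (mul_pos hf hg).ne' ?_
      linear_combination -K.r * K.g * f1 + K.g * K.e * f3

/-- The product of the polynomials `B` vanishes for edge lengths which can be given signs as in
`signed_B_eq_zero`. -/
theorem B_product_eq_zero {K : OctahedronMetric} {σ₁ σ₂ σ₃ τ₁ τ₂ τ₃ : ℝ} (hσ₁ : σ₁ = 1 ∨ σ₁ = -1)
    (hσ₂ : σ₂ = 1 ∨ σ₂ = -1) (hσ₃ : σ₃ = 1 ∨ σ₃ = -1) (hτ₁ : τ₁ = 1 ∨ τ₁ = -1)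
    (hτ₂ : τ₂ = 1 ∨ τ₂ = -1) (hτ₃ : τ₃ = 1 ∨ τ₃ = -1)
    (hsign : σ₃ * τ₃ * (σ₁ * τ₁) * (σ₂ * τ₂) = -1) (oy : ¬ (K.p = K.e ∧ K.r = K.b))
    (sx : K.q + τ₃ * K.a + τ₁ * K.s + τ₃ * τ₁ * K.d = 0)
    (sy : K.p + σ₁ * K.r + τ₂ * K.b + σ₁ * τ₂ * K.e = 0)
    (sz : K.c + σ₃ * K.f + σ₂ * K.g + σ₃ * σ₂ * K.h = 0)
    (p2 : K.b * K.h * K.q = K.c * K.d * K.r) (p3 : K.r * K.g * K.a = K.s * K.f * K.b)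
    (p4 : K.a * K.p * K.h = K.c * K.s * K.e)
    (c6 : (K.b ^ 2 + K.a ^ 2 - K.c ^ 2) * (K.e * K.d) =
      σ₁ * τ₁ * (K.e ^ 2 + K.d ^ 2 - K.h ^ 2) * (K.b * K.a))
    (c2 : (K.p ^ 2 + K.g ^ 2 - K.s ^ 2) * (K.b * K.c) =
      σ₂ * τ₂ * (K.b ^ 2 + K.c ^ 2 - K.a ^ 2) * (K.p * K.g)) :
    K.B 1 1 1 * K.B 1 (-1) (-1) * K.B (-1) 1 (-1) * K.B (-1) (-1) 1 = 0 := by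
  obtain ⟨ha, hb, hc, hd, he, hf, hg, hh, hp, hq, hr, hs⟩ := K.pos
  have ne_zero : ∀ {σ : ℝ}, σ = 1 ∨ σ = -1 → σ ≠ 0 := by
    rintro σ (rfl | rfl) <;> norm_num
  have sq_one : ∀ {σ : ℝ}, σ = 1 ∨ σ = -1 → σ ^ 2 = 1 := by
    rintro σ (rfl | rfl) <;> norm_num
  have q1 := sq_one hσ₁
  have q2 := sq_one hσ₂
  have q3 := sq_one hσ₃
  have t1 := sq_one hτ₁
  have t2 := sq_one hτ₂
  have t3 := sq_one hτ₃
  -- The total sign −1 is what turns the positive proportionalities into the negative ones required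
  -- for signed edges.
  have n₁ : τ₂ * σ₃ * σ₂ = -(τ₃ * τ₁ * σ₁) := by
    rcases hσ₁ with rfl | rfl <;> rcases hτ₁ with rfl | rfl <;> rcases hτ₃ with rfl | rfl <;>
      linarith
  have n₂ : σ₁ * σ₂ * τ₃ = -(τ₁ * σ₃ * τ₂) := by
    rcases hτ₁ with rfl | rfl <;> rcases hσ₃ with rfl | rfl <;> rcases hτ₂ with rfl | rfl <;>
      linarith
  have n₃ : τ₃ * σ₃ * σ₂ = -(τ₁ * σ₁ * τ₂) := by
    rcases hτ₁ with rfl | rfl <;> rcases hσ₁ with rfl | rfl <;> rcases hτ₂ with rfl | rfl <;>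
      linarith
  -- If this vanished, so would the rest of the sum, and positivity would give r = b and p = e.
  have hrb : σ₁ * K.r + τ₂ * K.b ≠ 0 := by
    intro h0
    refine oy ?_
    have h1 : K.p + σ₁ * τ₂ * K.e = 0 := by linarith
    rcases hσ₁ with rfl | rfl <;> rcases hτ₂ with rfl | rfl <;> constructor <;> linarith
  have hB := signed_B_eq_zero (a := τ₃ * K.a) (b := τ₂ * K.b) (c := K.c) (d := τ₃ * τ₁ * K.d)
    (e := σ₁ * τ₂ * K.e) (f := σ₃ * K.f) (g := σ₂ * K.g) (h := σ₃ * σ₂ * K.h) (p := K.p)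
    (q := K.q) (r := σ₁ * K.r) (s := τ₁ * K.s) (mul_ne_zero (ne_zero hτ₃) ha.ne')
    (mul_ne_zero (ne_zero hτ₂) hb.ne') hc.ne'
    (mul_ne_zero (ne_zero (sign_mul_sign hσ₃ hσ₂)) hh.ne') (mul_ne_zero (ne_zero hτ₁) hs.ne') hrb
    (by linarith) (by linarith) (by linarith)
    (by linear_combination τ₂ * σ₃ * σ₂ * p2 + K.c * K.d * K.r * n₁)
    (by linear_combination σ₁ * σ₂ * τ₃ * p3 + K.s * K.f * K.b * n₂)
    (by linear_combination τ₃ * σ₃ * σ₂ * p4 + K.c * K.s * K.e * n₃)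
    (by
      simp only [mul_pow, q1, q2, q3, t1, t2, t3, one_mul]
      linear_combination σ₁ * τ₁ * τ₂ * τ₃ * c6 + τ₂ * τ₃ * (K.e ^ 2 + K.d ^ 2 - K.h ^ 2) *
        (K.b * K.a) * (τ₁ ^ 2 * q1 + t1))
    (by
      simp only [mul_pow, q2, t1, t2, t3, one_mul]
      linear_combination τ₂ * c2 + σ₂ * (K.b ^ 2 + K.c ^ 2 - K.a ^ 2) * (K.p * K.g) * t2)
  simp only [mul_pow, q1, q2, q3, t1, t2, t3, one_mul] at hB
  have hB' : K.B (-(τ₃ * τ₁)) (-(σ₃ * σ₂)) (-(σ₁ * τ₂)) = 0 := by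
    have hlin : ∀ m : ℝ, τ₃ * τ₂ * m = 0 → m = 0 := fun m hm =>
      (mul_eq_zero.1 hm).resolve_left (ne_zero (sign_mul_sign hτ₃ hτ₂))
    refine hlin _ ?_
    unfold B
    rw [← hB]
    rcases hσ₁ with rfl | rfl <;> rcases hτ₁ with rfl | rfl <;> rcases hτ₃ with rfl | rfl <;>
      rcases hσ₃ with rfl | rfl <;> rcases hτ₂ with rfl | rfl <;> rcases hσ₂ with rfl | rfl <;>
      first
      | (exfalso; norm_num at hsign; done)
      | ring
  -- The three indices have product 1, which leaves exactly the four polynomials in the product.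
  have hprod : -(τ₃ * τ₁) * -(σ₃ * σ₂) * -(σ₁ * τ₂) = 1 := by linear_combination -hsign
  have sign_neg : ∀ {σ : ℝ}, σ = 1 ∨ σ = -1 → -σ = 1 ∨ -σ = -1 := by
    rintro σ (rfl | rfl) <;> norm_num
  rcases sign_neg (sign_mul_sign hτ₃ hτ₁) with h1 | h1 <;>
    rcases sign_neg (sign_mul_sign hσ₃ hσ₂) with h2 | h2 <;>
    rcases sign_neg (sign_mul_sign hσ₁ hτ₂) with h3 | h3 <;>
    rw [h1, h2, h3] at hB' hprod <;>
    first
    | (exfalso; norm_num at hprod; done)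
    | (rw [hB']; ring)

/-- If the three diagonals generate the same field, the octahedron is of type A or B. -/
theorem typeA_or_typeB_of_adjoin_eq {K : OctahedronMetric} {L : Type*} [Field L] [Algebra ℝ L]
    {x y z : L} (h : K.GenericFlex x y z) (hxz : ℝ⟮x⟯ = ℝ⟮z⟯) (hyz : ℝ⟮y⟯ = ℝ⟮z⟯) :
    K.TypeA ∨ K.TypeB := by
  obtain ⟨ha, hb, hc, hd, he, hf, hg, hh, hp, hq, hr, hs⟩ := K.pos
  have hx := h.trans_x
  have hy := h.trans_y
  have hz := h.trans_z
  have mem : ∀ {u v : L}, ℝ⟮u⟯ = ℝ⟮v⟯ → u ∈ ℝ⟮v⟯ := fun e => e ▸ mem_adjoin_simple_self ℝ _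
  have hxy : ℝ⟮x⟯ = ℝ⟮y⟯ := hxz.trans hyz.symm
  obtain ⟨σ₃, τ₃, σ₅, τ₅, k₁, hσ₃, hτ₃, hσ₅, hτ₅, i3, i5, l3, l5, u3, w3, e1⟩ :=
    h.flex₃.bilinear_of_mem_mem h.flex₅ hx hz (mem hxz) (mem hxz.symm)
  obtain ⟨σ₁, τ₁, σ₆, τ₆, k₂, hσ₁, hτ₁, hσ₆, hτ₆, i1, i6, l1, l6, u1, w1, e2⟩ :=
    h.flex₁.bilinear_of_mem_mem h.flex₆ hx hy (mem hxy) (mem hxy.symm)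
  obtain ⟨σ₂, τ₂, σ₄, τ₄, k₃, hσ₂, hτ₂, hσ₄, hτ₄, i2, i4, l2, l4, u2, w2, e3⟩ :=
    h.flex₂.bilinear_of_mem_mem h.flex₄ hy hz (mem hyz) (mem hyz.symm)
  obtain ⟨p1, p2, p3, p4⟩ := proportionality_of_isogram i1 i2 i3 i4 i5 i6
  have u3' : (K.c + σ₃ * K.f) ^ 2 = (K.g + σ₅ * K.h) ^ 2 := u3
  have w3' : (K.q + τ₃ * K.a) ^ 2 = (K.s + τ₅ * K.d) ^ 2 := w3
  have u1' : (K.p + σ₁ * K.r) ^ 2 = (K.b + σ₆ * K.e) ^ 2 := u1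
  have w1' : (K.q + τ₁ * K.s) ^ 2 = (K.a + τ₆ * K.d) ^ 2 := w1
  have u2' : (K.c + σ₂ * K.g) ^ 2 = (K.f + σ₄ * K.h) ^ 2 := u2
  have w2' : (K.p + τ₂ * K.b) ^ 2 = (K.r + τ₄ * K.e) ^ 2 := w2
  obtain ⟨qx1, qx2, qx3, qx4⟩ := h.quad_x
  obtain ⟨qy1, qy2, qy3, qy4⟩ := h.quad_y
  have zz : EquatorZeroSum K.c K.f K.h K.g := equatorZeroSum_of_sq_eq h.quad_z hσ₃ hσ₅ u3'
  have zy : EquatorZeroSum K.b K.p K.r K.e :=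
    (equatorZeroSum_of_sq_eq (w := K.p) (x := K.b) (y := K.e) (z := K.r)
      ⟨by linarith, by linarith, by linarith, by linarith⟩ hτ₂ hτ₄ w2').swap
  have zx : EquatorZeroSum K.s K.q K.a K.d :=
    (equatorZeroSum_of_sq_eq (w := K.q) (x := K.s) (y := K.d) (z := K.a)
      ⟨by linarith, by linarith, by linarith, by linarith⟩ hτ₁ hτ₆ w1').swap
  -- Equal opposite sides would allow two different zero sums on an equator and leave its signs
  -- undetermined.
  by_cases ho : (K.c = K.h ∧ K.f = K.g) ∨ (K.p = K.e ∧ K.r = K.b) ∨ (K.q = K.d ∧ K.a = K.s)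
  · exact Or.inl (typeA_of_opposite_eq zz zy zx p1 p2 p3 ho)
  have oz := fun h0 => ho (Or.inl h0)
  have oy := fun h0 => ho (Or.inr (Or.inl h0))
  have ox := fun h0 => ho (Or.inr (Or.inr h0))
  right
  refine ⟨⟨zz, zy, zx⟩, ⟨p1, p2, p3⟩, ?_⟩
  have sz : K.c + σ₃ * K.f + σ₂ * K.g + σ₃ * σ₂ * K.h = 0 :=
    signed_sum_eq_zero hc hf hh hg h.quad_z oz hσ₃ hσ₂ hσ₅ hσ₄ u3' u2'
  have sy : K.p + σ₁ * K.r + τ₂ * K.b + σ₁ * τ₂ * K.e = 0 :=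
    signed_sum_eq_zero hp hr he hb ⟨by linarith, by linarith, by linarith, by linarith⟩ oy hσ₁ hτ₂
      hσ₆ hτ₄ u1' w2'
  have sx : K.q + τ₃ * K.a + τ₁ * K.s + τ₃ * τ₁ * K.d = 0 :=
    signed_sum_eq_zero hq ha hd hs ⟨by linarith, by linarith, by linarith, by linarith⟩ ox hτ₃ hτ₁
      hτ₅ hτ₆ w3' w1'
  have hk₂ : k₂ ≠ 0 := by rintro rfl; simp at l1
  have hk₃ : k₃ ≠ 0 := by rintro rfl; simp at l2
  have hneg : k₁ * k₂ * k₃ < 0 := bilinear_constants_mul_neg hz hk₂ hk₃ e1 e2 e3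
  -- At each vertex στ has the sign of its constant k, so k₁k₂k₃ < 0 gives the product of the six
  -- signs.
  have hsign : σ₃ * τ₃ * (σ₁ * τ₁) * (σ₂ * τ₂) = -1 := by
    refine (sign_mul_sign (sign_mul_sign (sign_mul_sign hσ₃ hτ₃) (sign_mul_sign hσ₁ hτ₁))
      (sign_mul_sign hσ₂ hτ₂)).resolve_left fun h1 => ?_
    have := mul_pos (mul_pos l3 l1) l2
    have e : σ₃ * τ₃ * k₁ * (σ₁ * τ₁ * k₂) * (σ₂ * τ₂ * k₃) =
        σ₃ * τ₃ * (σ₁ * τ₁) * (σ₂ * τ₂) * (k₁ * k₂ * k₃) := by ring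
    rw [e, h1] at this
    linarith
  -- Opposite vertices share the constant k₂, hence are both isograms or both anti-isograms.
  have ε6 : σ₆ * τ₆ = σ₁ * τ₁ :=
    eq_of_sign_mul_pos (sign_mul_sign hσ₆ hτ₆) (sign_mul_sign hσ₁ hτ₁) l6 l1
  have c6 : (K.b ^ 2 + K.a ^ 2 - K.c ^ 2) * (K.e * K.d) =
      σ₁ * τ₁ * (K.e ^ 2 + K.d ^ 2 - K.h ^ 2) * (K.b * K.a) :=
    cosLaw_cross_mul hb ha he hd (by rw [← ε6]; exact i6.2.1)
  have c2 : (K.p ^ 2 + K.g ^ 2 - K.s ^ 2) * (K.b * K.c) =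
      σ₂ * τ₂ * (K.b ^ 2 + K.c ^ 2 - K.a ^ 2) * (K.p * K.g) :=
    cosLaw_cross_mul hp hg hb hc i2.2.2
  exact B_product_eq_zero hσ₁ hσ₂ hσ₃ hτ₁ hτ₂ hτ₃ hsign oy sx sy sz p2 p3 p4 c6 c2

end OctahedronMetric

theorem mainTheorem1 (K : OctahedronMetric) (hK : K.NontriviallyFlexible) :
    K.TypeA ∨ K.TypeB := by
  obtain ⟨L, _, _, x, y, z, h, h', h''⟩ := hK.exists_genericFlex
  by_cases hne : ℝ⟮x⟯ = ℝ⟮z⟯ ∧ ℝ⟮y⟯ = ℝ⟮z⟯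
  · exact OctahedronMetric.typeA_or_typeB_of_adjoin_eq h hne.1 hne.2
  · exact Or.inl (OctahedronMetric.typeA_of_not_adjoin_eq h h' h'' hne)
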